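/- Let $\mathbb T=\mathbb R/(2\pi\mathbb Z)$ and let all functions be real-valued. For $s\in\mathbb R$ put $\|u\|_{H^s}=\|(1-\partial_x^2)^{s/2}u\|_{L^2(\mathbb T)}=\big(\sum_{k\in\mathbb Z}(1+k^2)^s|\hat u_k|^2\big)^{1/2}$, where $\hat u_k=\frac1{2\pi}\int_{\mathbb T}u(x)e^{-ikx}\,dx$ (and $L^2(\mathbb T)$ is normed with respect to $dx/2\pi$), and let $H^1(\mathbb T)$ be the space of all $u\in L^2(\mathbb T)$ with $\|u\|_{H^1}<\infty$. Let $f\in C^1(\mathbb R)$ satisfy $f(y)\ge 0$ for all $y\in\mathbb R$, and suppose that for some $\delta>0$ the only solution $y\in(-\delta,\delta)$ of $f(y)=0$ is $y=0$. Let $a\in C^\infty(\mathbb T)$ satisfy $a\ge 0$ on $\mathbb T$ and $a(x)>0$ for at least one $x\in\mathbb T$. Consider $$u_t-u_{txx}+[f(u)]_x+a(x)u=0\quad (x\in\mathbb T,\ t\ge 0),\qquad u(x,0)=u_0(x).\qquad(*)$$ For $T>0$, a solution of $(*)$ on $[0,T]$ in the class $C([0,T];H^1(\mathbb T))$ is a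 function $u\in C([0,T];H^1(\mathbb T))$ with $u(0)=u_0$ which satisfies the equation in the sense of distributions on $(0,T)\times\mathbb T$. Let $u_0\in H^1(\mathbb T)$. Then there is a function $u:[0,\infty)\to H^1(\mathbb T)$ such that for every $T>0$ its restriction to $[0,T]$ is a solution of $(*)$ in $C([0,T];H^1(\mathbb T))$, and it is the only solution of $(*)$ in that class. Furthermore, as $t\to+\infty$, $u(t)\to 0$ weakly in $H^1(\mathbb T)$ and, for every real $s<1$, $\|u(t)\|_{H^s}\to 0$. -/

import Mathlib

open Set Filter Topology MeasureTheory
open scoped Real ContDiff ENNReal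

noncomputable section

namespace BBM

instance instFactTwoPiPos : Fact (0 < 2 * π) := ⟨Real.two_pi_pos⟩

/-- The one-dimensional torus `ℝ / 2πℤ`. -/
abbrev Torus : Type := AddCircle (2 * π)

/-- Real-valued square integrable functions on the torus, modulo equality almost everywhere. The
reference measure is the invariant probability measure `dx / 2π`. -/
abbrev L2 : Type := Lp ℝ 2 (AddCircle.haarAddCircle (T := 2 * π))

/-- Fourier coefficient `(2π)⁻¹ ∫ u(x) e^{-ikx} dx` of a real-valued `L²` function. -/
def fc (u : L2) (k : ℤ) : ℂ := fourierCoeff (fun x : Torus => ((u x : ℝ) : ℂ)) k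

/-- The norm `(∑ₖ (1 + k²)^s |ûₖ|²)^{1/2}` of `(1 - ∂ₓ²)^{s/2} u` in `L²`, an element of `[0, ∞]`,
for any real order `s`. -/
def sobolevENorm (s : ℝ) (u : L2) : ℝ≥0∞ :=
  (∑' k : ℤ, ENNReal.ofReal ((1 + (k : ℝ) ^ 2) ^ s * ‖fc u k‖ ^ 2)) ^ (1 / 2 : ℝ)

/-- The embedding of real-valued functions into complex-valued functions. -/
def complexify : L2 →L[ℝ] Lp ℂ 2 (AddCircle.haarAddCircle (T := 2 * π)) :=
  Complex.ofRealCLM.compLpL 2 AddCircle.haarAddCircle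

theorem complexify_coe (u : L2) :
    (complexify u : Torus → ℂ) =ᵐ[AddCircle.haarAddCircle] fun x => ((u x : ℝ) : ℂ) :=
  Complex.ofRealCLM.coeFn_compLpL u

theorem fc_eq_repr (u : L2) (k : ℤ) : fc u k = fourierBasis.repr (complexify u) k := by
  rw [fourierBasis_repr]
  unfold fc fourierCoeff
  refine integral_congr_ae ?_
  filter_upwards [complexify_coe u] with x hx
  simp only [hx]

theorem fc_add (u v : L2) (k : ℤ) : fc (u + v) k = fc u k + fc v k := by
  simp [fc_eq_repr]

theorem fc_smul (c : ℝ) (u : L2) (k : ℤ) : fc (c • u) k = (c : ℂ) * fc u k := by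
  have h : complexify (c • u) = (c : ℂ) • complexify u := by
    rw [map_smul]
    apply Lp.ext
    filter_upwards [Lp.coeFn_smul c (complexify u), Lp.coeFn_smul (c : ℂ) (complexify u)]
      with x h1 h2
    rw [h1, h2]
    simp
  rw [fc_eq_repr, h, map_smul, fc_eq_repr]
  rfl

theorem fc_injective {u : L2} (h : ∀ k, fc u k = 0) : u = 0 := by
  have h0 : complexify u = 0 := by
    apply fourierBasis.repr.injective
    rw [map_zero]
    ext k
    rw [← fc_eq_repr, h k]
    rfl
  have h1 := complexify_coe u
  rw [h0] at h1
  rw [Lp.eq_zero_iff_ae_eq_zero]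
  filter_upwards [h1, Lp.coeFn_zero ℂ 2 (AddCircle.haarAddCircle (T := 2 * π))] with x hx hx0
  rw [hx0] at hx
  simpa using hx.symm

/-- The weighted Fourier coefficients `(1 + k²)^{1/2} ûₖ`. -/
def wfc (u : L2) : ℤ → ℂ := fun k => ((√(1 + (k : ℝ) ^ 2) : ℝ) : ℂ) * fc u k

theorem norm_wfc_sq (u : L2) (k : ℤ) :
    ‖wfc u k‖ ^ 2 = (1 + (k : ℝ) ^ 2) * ‖fc u k‖ ^ 2 := by
  have h : (0 : ℝ) ≤ 1 + (k : ℝ) ^ 2 := by positivity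
  rw [wfc, norm_mul, mul_pow, Complex.norm_real, Real.norm_eq_abs, sq_abs, Real.sq_sqrt h]

theorem wfc_add (u v : L2) : wfc (u + v) = wfc u + wfc v := by
  funext k
  simp [wfc, fc_add, mul_add]

theorem wfc_smul (c : ℝ) (u : L2) : wfc (c • u) = c • wfc u := by
  funext k
  simp [wfc, fc_smul, mul_left_comm]

theorem sobolevENorm_one_lt_top_iff (u : L2) : sobolevENorm 1 u < ⊤ ↔ Memℓp (wfc u) 2 := by
  rw [memℓp_gen_iff (by norm_num), sobolevENorm, ENNReal.rpow_lt_top_iff_of_pos (by norm_num)]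
  have h : ∀ k : ℤ, ENNReal.ofReal ((1 + (k : ℝ) ^ 2) ^ (1 : ℝ) * ‖fc u k‖ ^ 2)
      = ENNReal.ofReal (‖wfc u k‖ ^ (2 : ℝ≥0∞).toReal) := by
    intro k
    rw [Real.rpow_one, ← norm_wfc_sq]
    norm_num
  simp_rw [h]
  constructor
  · intro hs
    have := ENNReal.summable_toReal hs.ne
    refine this.congr fun k => ?_
    rw [ENNReal.toReal_ofReal (by positivity)]
  · intro hs
    rw [← ENNReal.ofReal_tsum_of_nonneg (fun k => by positivity) hs]
    exact ENNReal.ofReal_lt_top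

/-- The `L²` functions whose `H¹` norm is finite, as a real vector space. -/
def H1Submodule : Submodule ℝ L2 where
  carrier := {u | sobolevENorm 1 u < ⊤}
  add_mem' {u v} hu hv := by
    rw [mem_ofPred_eq, sobolevENorm_one_lt_top_iff] at *
    rw [wfc_add]
    exact hu.add hv
  zero_mem' := by
    rw [mem_ofPred_eq, sobolevENorm_one_lt_top_iff]
    have : wfc 0 = 0 := by simpa using wfc_smul 0 0
    rw [this]
    exact zero_memℓp
  smul_mem' c u hu := by
    rw [mem_ofPred_eq, sobolevENorm_one_lt_top_iff] at *
    rw [wfc_smul]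
    exact hu.const_smul c

/-- The Sobolev space `H¹(𝕋)` of real-valued functions. As a type of its own it carries the `H¹`
norm below, not that of `L²`. -/
def H1 : Type := H1Submodule

instance : AddCommGroup H1 := inferInstanceAs (AddCommGroup H1Submodule)

instance : Module ℝ H1 := inferInstanceAs (Module ℝ H1Submodule)

/-- The inclusion of `H¹` into `L²`. -/
def H1.toL2 : H1 →ₗ[ℝ] L2 := H1Submodule.subtype

/-- An element of `H¹` viewed as a function on the torus. -/
instance : CoeFun H1 (fun _ => Torus → ℝ) := ⟨fun u => (H1.toL2 u : Torus → ℝ)⟩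

/-- The map `u ↦ ((1 + k²)^{1/2} ûₖ)ₖ` from `H¹` to `ℓ²`. -/
def H1.toEll2 : H1 →ₗ[ℝ] lp (fun _ : ℤ => ℂ) 2 where
  toFun u := ⟨wfc (H1.toL2 u), (sobolevENorm_one_lt_top_iff _).1 u.2⟩
  map_add' u v := by
    apply Subtype.ext
    exact wfc_add _ _
  map_smul' c u := by
    apply Subtype.ext
    exact wfc_smul _ _

theorem H1.toEll2_injective : Function.Injective H1.toEll2 := by
  rw [injective_iff_map_eq_zero]
  intro u hu
  apply Subtype.ext
  apply fc_injective
  intro k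
  have h : wfc (H1.toL2 u) k = 0 := congrFun (congrArg Subtype.val hu) k
  have hk : √(1 + (k : ℝ) ^ 2) ≠ 0 := by positivity
  exact (mul_eq_zero.1 h).resolve_left (by exact_mod_cast hk)

/-- The `H¹` norm, transported from `ℓ²`. -/
instance : NormedAddCommGroup H1 := NormedAddCommGroup.induced _ _ H1.toEll2 H1.toEll2_injective

instance : NormedSpace ℝ H1 := NormedSpace.induced ℝ H1 _ H1.toEll2

theorem H1.norm_sq (u : H1) :
    ‖u‖ ^ 2 = ∑' k : ℤ, (1 + (k : ℝ) ^ 2) * ‖fc (H1.toL2 u) k‖ ^ 2 := by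
  have h := lp.norm_rpow_eq_tsum (p := 2) (by norm_num) (H1.toEll2 u)
  have h2 : ‖u‖ = ‖H1.toEll2 u‖ := rfl
  norm_num at h
  rw [h2, h]
  exact tsum_congr fun k => norm_wfc_sq _ _

/-- Smooth functions on the torus: their `2π`-periodic lifts to `ℝ` are smooth. -/
def SmoothOnTorus (φ : Torus → ℝ) : Prop := ContDiff ℝ ∞ (fun x : ℝ => φ x)

/-- The function `u : [0, T] → H¹(𝕋)` is continuous, satisfies `u(0) = u₀`, and solves
`u_t - u_txx + [f(u)]_x + a(x) u = 0` in the sense of distributions on `(0, T)` with values in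
distributions on `𝕋`: the equation is tested against `ψ(t) φ(x)` with `ψ` smooth and compactly
supported in `(0, T)` and `φ` smooth on `𝕋`, all derivatives being moved to `ψ` and `φ`.
The values of `u` outside `[0, T]` play no role. -/
structure IsSolution (f : ℝ → ℝ) (a : Torus → ℝ) (u₀ : H1) (T : ℝ) (u : ℝ → H1) : Prop where
  continuousOn : ContinuousOn u (Icc 0 T)
  initial : u 0 = u₀
  equation : ∀ ψ : ℝ → ℝ, ContDiff ℝ ∞ ψ → HasCompactSupport ψ → tsupport ψ ⊆ Ioo 0 T →
    ∀ φ : Torus → ℝ, SmoothOnTorus φ →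
      ∫ t in (0 : ℝ)..T, ∫ x in (0 : ℝ)..(2 * π),
        (-(deriv ψ t * u t (x : Torus) *
              (φ x - iteratedDeriv 2 (fun y : ℝ => φ y) x))
          - ψ t * f (u t (x : Torus)) * deriv (fun y : ℝ => φ y) x
          + ψ t * a x * u t (x : Torus) * φ x) = 0

end BBM

end

noncomputable section

namespace BBM

open scoped InnerProductSpace ComplexConjugate

/-! Put `w = (1 + ∂ₓ)u`. Since `|1 + ik|² = 1 + k²`, the operator `(1 + ∂ₓ)⁻¹` is an isometry of
`L²` onto `H¹` (`resH1`), and its `L²` adjoint is `(1 - ∂ₓ)⁻¹`. As `1 - ∂ₓ² = (1 - ∂ₓ)(1 + ∂ₓ)` and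
`-∂ₓ f(u) = (1 - ∂ₓ)f(u) - f(u)`, the equation becomes the ODE `w' = f(u) - (1 - ∂ₓ)⁻¹(f(u) + a u)`
in `L²`, whose right side (`field`) is locally Lipschitz because `L²` maps boundedly into continuous
functions under `(1 + ∂ₓ)⁻¹`.

Since `∫ f(u) uₓ = 0`, one has `⟪w, w'⟫ = -∫ a u² ≤ 0` (`inner_field`). Hence `‖w‖` does not
increase and solutions are global. Uniqueness for the ODE passes to distributional solutions because
each of these, on testing, satisfies the ODE (`IsSolution.exists_hasDerivWithinAt`).

For the decay, Barbalat's lemma applied to `‖w‖²` gives `∫ a u² → 0`, so `a u → 0` in `L²`; applied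
again to `a u` it gives `a uₜ → 0`. The operator `(1 + ∂ₓ)⁻¹` is compact from `L²` to continuous
functions, so `u(t)` has uniform limit points `g`. For such a `g`, with `h = f(g) ≥ 0`, the two
limits say that `g` and `(1 + ∂ₓ)⁻¹(h - (1 - ∂ₓ)⁻¹h)` vanish where `a ≠ 0`. A unique continuation
argument using the sign of `h` forces `h = 0` (`eq_zero_of_mul_resC_eq_zero`). Then `g` takes values
in the zeros of `f` and vanishes somewhere; as `0` is an isolated zero, connectedness gives `g = 0`.
Thus `u → 0` uniformly, and boundedness in `H¹` upgrades this to weak `H¹` convergence and to strong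
`H^s` convergence for `s < 1`. -/

/-- The normalized Haar measure on the torus. -/
abbrev haar : Measure Torus := AddCircle.haarAddCircle (T := 2 * π)

/-! ### Fourier coefficients of real `L²` functions -/

/-- The inclusion of continuous functions into `L²`. -/
def ofC : C(Torus, ℝ) →L[ℝ] L2 := ContinuousMap.toLp 2 haar ℝ

theorem ofC_coe (p : C(Torus, ℝ)) : (ofC p : Torus → ℝ) =ᵐ[haar] p :=
  ContinuousMap.coeFn_toLp haar p

theorem fc_ofC (p : C(Torus, ℝ)) (k : ℤ) :
    fc (ofC p) k = fourierCoeff (fun x : Torus => ((p x : ℝ) : ℂ)) k := by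
  refine congrFun (fourierCoeff_congr_ae ?_) k
  filter_upwards [ofC_coe p] with x hx
  rw [hx]

theorem fc_ext {u v : L2} (h : ∀ k, fc u k = fc v k) : u = v := by
  rw [← sub_eq_zero]
  apply fc_injective
  intro k
  have := fc_add (u - v) v k
  rw [sub_add_cancel, h k] at this
  simpa using this.symm

theorem norm_complexify (u : L2) : ‖complexify u‖ = ‖u‖ := by
  rw [Lp.norm_def, Lp.norm_def]
  congr 1
  apply eLpNorm_congr_norm_ae
  filter_upwards [complexify_coe u] with x hx
  rw [hx, Complex.norm_real]

theorem hasSum_norm_fc_sq (u : L2) : HasSum (fun k => ‖fc u k‖ ^ 2) (‖u‖ ^ 2) := by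
  have h := lp.hasSum_norm (p := 2) (by norm_num) (fourierBasis.repr (complexify u))
  simp only [ENNReal.toReal_ofNat, Real.rpow_ofNat, LinearIsometryEquiv.norm_map,
    norm_complexify, ← fc_eq_repr] at h
  exact h

theorem fc_neg (u : L2) (k : ℤ) : fc u (-k) = conj (fc u k) := by
  unfold fc fourierCoeff
  rw [← integral_conj]
  refine integral_congr_ae (Eventually.of_forall fun x => ?_)
  simp

theorem fourierCoeff_re {g : Torus → ℂ} (hg : Integrable g haar) (k : ℤ) :
    fourierCoeff (fun x => (((g x).re : ℝ) : ℂ)) k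
      = (fourierCoeff g k + conj (fourierCoeff g (-k))) / 2 := by
  have h1 := hg.fourier_smul (-k)
  have h2 := hg.fourier_smul k
  have h3 : Integrable (fun t => conj ((fourier k : C(Torus, ℂ)) t • g t)) haar :=
    Complex.conjCLE.toContinuousLinearMap.integrable_comp h2
  unfold fourierCoeff
  rw [← integral_conj, neg_neg, ← integral_add h1 h3, ← integral_div]
  refine integral_congr_ae (Eventually.of_forall fun x => ?_)
  simp only [smul_eq_mul, map_mul, ← fourier_neg, Complex.re_eq_add_conj]
  ring

/-- The `k`-th Fourier coefficient as a continuous linear map. -/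
def fcL (k : ℤ) : L2 →L[ℝ] ℂ :=
  LinearMap.mkContinuous
    { toFun := fun u => fc u k
      map_add' := fun u v => fc_add u v k
      map_smul' := fun c u => by simp [fc_smul] } 1 (by
    intro u
    have h := (hasSum_norm_fc_sq u).summable.le_tsum k (fun j _ => by positivity)
    rw [(hasSum_norm_fc_sq u).tsum_eq] at h
    simpa using (pow_le_pow_iff_left₀ (norm_nonneg _) (norm_nonneg u) two_ne_zero).1 h)

@[simp] theorem fcL_apply (k : ℤ) (u : L2) : fcL k u = fc u k := rfl

/-! ### The operator `(1 + ∂ₓ)⁻¹`: compactness, and isometry onto `H¹` -/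

/-- The symbol of the operator `(1 + ∂ₓ)⁻¹`. -/
def symb (k : ℤ) : ℂ := (1 + Complex.I * k)⁻¹

theorem one_add_I_mul_ne_zero (k : ℤ) : (1 + Complex.I * k : ℂ) ≠ 0 := by
  intro h
  simpa using congrArg Complex.re h

theorem norm_sq_one_add_I_mul (k : ℤ) : ‖(1 + Complex.I * k : ℂ)‖ ^ 2 = 1 + (k : ℝ) ^ 2 := by
  rw [← Complex.normSq_eq_norm_sq, Complex.normSq_apply]
  simp [pow_two]

theorem norm_symb_sq (k : ℤ) : ‖symb k‖ ^ 2 = (1 + (k : ℝ) ^ 2)⁻¹ := by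
  rw [symb, norm_inv, inv_pow, norm_sq_one_add_I_mul]

theorem symb_neg (k : ℤ) : symb (-k) = conj (symb k) := by
  simp [symb]

theorem summable_norm_symb_sq : Summable fun k => ‖symb k‖ ^ 2 := by
  have h : Summable fun k : ℤ => ((k : ℝ) ^ 2)⁻¹ := by
    simpa using Real.summable_one_div_int_pow.2 (one_lt_two)
  refine Summable.of_norm_bounded_eventually h ?_
  have : {(0 : ℤ)}ᶜ ∈ (cofinite : Filter ℤ) :=
    (finite_singleton 0).compl_mem_cofinite
  filter_upwards [this] with k hk
  have hk' : (0 : ℝ) < (k : ℝ) ^ 2 := by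
    have : (k : ℝ) ≠ 0 := by exact_mod_cast hk
    positivity
  rw [norm_symb_sq, Real.norm_of_nonneg (by positivity)]
  exact inv_anti₀ hk' (by linarith)

/-- The `k`-th mode of `(1 + ∂ₓ)⁻¹`. -/
def resolventMode (k : ℤ) : L2 →L[ℝ] C(Torus, ℂ) :=
  (fcL k).smulRight (symb k • (fourier k : C(Torus, ℂ)))

theorem resolventMode_apply (k : ℤ) (w : L2) :
    resolventMode k w = (symb k * fc w k) • (fourier k : C(Torus, ℂ)) := by
  simp [resolventMode, smul_smul, mul_comm]

theorem norm_sum_resolventMode_le (s : Finset ℤ) :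
    ‖∑ k ∈ s, resolventMode k‖ ≤ √(∑ k ∈ s, ‖symb k‖ ^ 2) := by
  refine ContinuousLinearMap.opNorm_le_bound _ (by positivity) fun w => ?_
  rw [sum_apply]
  calc ‖∑ k ∈ s, resolventMode k w‖ ≤ ∑ k ∈ s, ‖symb k‖ * ‖fc w k‖ := by
        refine (norm_sum_le _ _).trans (Finset.sum_le_sum fun k _ => ?_)
        rw [resolventMode_apply, norm_smul, fourier_norm, mul_one, norm_mul]
    _ ≤ √(∑ k ∈ s, ‖symb k‖ ^ 2) * √(∑ k ∈ s, ‖fc w k‖ ^ 2) :=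
        Real.sum_mul_le_sqrt_mul_sqrt _ _ _
    _ ≤ √(∑ k ∈ s, ‖symb k‖ ^ 2) * ‖w‖ := by
        gcongr
        apply Real.sqrt_le_iff.2 ⟨norm_nonneg _, _⟩
        rw [← (hasSum_norm_fc_sq w).tsum_eq]
        exact (hasSum_norm_fc_sq w).summable.sum_le_tsum s (fun j _ => by positivity)

/-- The symbol is in `ℓ²` but not in `ℓ¹`, so the modes are not absolutely summable; Cauchy–Schwarz
against the coefficients of `w` still makes the partial sums Cauchy in operator norm. -/
theorem summable_resolventMode : Summable resolventMode := by
  rw [summable_iff_vanishing_norm]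
  intro ε hε
  obtain ⟨s, hs⟩ := summable_iff_vanishing_norm.1 summable_norm_symb_sq (ε ^ 2) (by positivity)
  refine ⟨s, fun t ht => (norm_sum_resolventMode_le t).trans_lt ?_⟩
  rw [Real.sqrt_lt' hε]
  exact (le_abs_self _).trans_lt (hs t ht)

/-- The operator `(1 + ∂ₓ)⁻¹` with values in complex-valued continuous functions. -/
def resolventC : L2 →L[ℝ] C(Torus, ℂ) := ∑' k, resolventMode k

/-- An operator-norm limit of finite-rank operators is compact. -/
theorem isCompactOperator_resolventC : IsCompactOperator resolventC := by
  refine isCompactOperator_of_tendsto (summable_resolventMode.hasSum) (Eventually.of_forall ?_)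
  intro s
  induction s using Finset.induction_on with
  | empty => simpa using! isCompactOperator_zero
  | insert k s hk ih =>
    rw [Finset.sum_insert hk]
    refine IsCompactOperator.add ?_ ih
    exact (isCompactOperator_of_locallyCompactSpace_dom (fcL k)).continuous_comp
      (g := fun z : ℂ => z • (symb k • (fourier k : C(Torus, ℂ)))) (by fun_prop)

theorem fourierCoeff_resolventC (w : L2) (k : ℤ) :
    fourierCoeff (resolventC w) k = symb k * fc w k := by
  have h1 : HasSum (fun j => resolventMode j w) (resolventC w) := by
    have h := (ContinuousLinearMap.apply ℝ C(Torus, ℂ) w).hasSum summable_resolventMode.hasSum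
    simp only [ContinuousLinearMap.apply_apply] at h
    exact h
  have h2 := (ContinuousMap.toLp (E := ℂ) 2 haar ℂ).hasSum h1
  have h3 := (innerSL ℂ (fourierBasis k)).hasSum h2
  simp only [innerSL_apply_apply, ← HilbertBasis.repr_apply_apply, fourierBasis_repr,
    fourierCoeff_toLp, resolventMode_apply] at h3
  refine h3.unique ?_
  refine (hasSum_ite_eq k (symb k * fc w k)).congr_fun fun j => ?_
  change fourierCoeff ((symb j * fc w j) • ⇑(fourier j : C(Torus, ℂ))) k = _
  rw [fourierCoeff.const_smul, fourierCoeff_fourier]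
  by_cases hj : j = k
  · subst hj; simp
  · have : k ≠ j := fun h => hj h.symm
    simp [hj, this]

/-- The operator `(1 + ∂ₓ)⁻¹` from `L²` to continuous functions. -/
def resC : L2 →L[ℝ] C(Torus, ℝ) :=
  (Complex.reCLM.compLeftContinuous ℝ Torus).comp resolventC

theorem resC_apply (w : L2) (x : Torus) : resC w x = (resolventC w x).re := rfl

theorem isCompactOperator_resC : IsCompactOperator resC :=
  isCompactOperator_resolventC.clm_comp (Complex.reCLM.compLeftContinuous ℝ Torus)

/-- The operator `(1 + ∂ₓ)⁻¹` on `L²`. -/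
def res : L2 →L[ℝ] L2 := ofC.comp resC

theorem res_apply (w : L2) : res w = ofC (resC w) := rfl

theorem integrable_of_continuousMap {E : Type*} [NormedAddCommGroup E] (g : C(Torus, E)) :
    Integrable g haar :=
  g.continuous.integrable_of_hasCompactSupport (HasCompactSupport.of_compactSpace _)

/-- Taking the real part loses nothing: both the symbol and the coefficients of a real function are
conjugated under `k ↦ -k`. -/
theorem fc_res (w : L2) (k : ℤ) : fc (res w) k = symb k * fc w k := by
  rw [res_apply, fc_ofC]
  simp only [resC_apply]
  rw [fourierCoeff_re (integrable_of_continuousMap _), fourierCoeff_resolventC,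
    fourierCoeff_resolventC, symb_neg, fc_neg]
  simp

theorem norm_wfc_res (w : L2) (k : ℤ) : ‖wfc (res w) k‖ = ‖fc w k‖ := by
  have h : ‖wfc (res w) k‖ ^ 2 = ‖fc w k‖ ^ 2 := by
    rw [norm_wfc_sq, fc_res, norm_mul, mul_pow, norm_symb_sq, ← mul_assoc,
      mul_inv_cancel₀ (by positivity), one_mul]
  exact (pow_left_inj₀ (norm_nonneg _) (norm_nonneg _) two_ne_zero).1 h

theorem res_mem_H1 (w : L2) : res w ∈ H1Submodule := by
  change sobolevENorm 1 (res w) < ⊤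
  rw [sobolevENorm_one_lt_top_iff, memℓp_gen_iff (by norm_num)]
  simpa [norm_wfc_res] using (hasSum_norm_fc_sq w).summable

/-- The isometry `(1 + ∂ₓ)⁻¹ : L² → H¹`. -/
def resH1 : L2 →ₗᵢ[ℝ] H1 where
  toFun w := (⟨res w, res_mem_H1 w⟩ : H1Submodule)
  map_add' u v := Subtype.ext (map_add res u v)
  map_smul' c u := Subtype.ext (map_smul res c u)
  norm_map' w := by
    refine (pow_left_inj₀ (norm_nonneg _) (norm_nonneg _) two_ne_zero).1 ?_
    rw [H1.norm_sq, ← (hasSum_norm_fc_sq w).tsum_eq]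
    refine tsum_congr fun k => ?_
    rw [← norm_wfc_sq, ← norm_wfc_res]
    rfl

/-- The preimage of `v` has coefficients `(1 + ik) v̂ₖ`, square summable exactly because `v` is in
`H¹`; their conjugation symmetry lets the real part be taken. -/
theorem resH1_surjective : Function.Surjective resH1 := by
  intro v
  have hc : Memℓp (fun k : ℤ => (1 + Complex.I * k) * fc (H1.toL2 v) k) 2 := by
    have h := (sobolevENorm_one_lt_top_iff _).1 v.2
    rw [memℓp_gen_iff (by norm_num)] at h ⊢
    refine h.congr fun k => ?_
    simp only [ENNReal.toReal_ofNat, Real.rpow_ofNat]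
    rw [norm_wfc_sq, norm_mul, mul_pow, norm_sq_one_add_I_mul]
    rfl
  set W : Lp ℂ 2 haar := fourierBasis.repr.symm ⟨_, hc⟩ with hW
  have hWk : ∀ k, fourierCoeff (W : Torus → ℂ) k = (1 + Complex.I * k) * fc (H1.toL2 v) k := by
    intro k
    rw [← fourierBasis_repr, hW, LinearIsometryEquiv.apply_symm_apply]
  have hint : Integrable (W : Torus → ℂ) haar := (Lp.memLp W).integrable (by norm_num)
  set w : L2 := Complex.reCLM.compLpL 2 haar W with hw
  have hwk : ∀ k, fc w k = (1 + Complex.I * k) * fc (H1.toL2 v) k := by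
    intro k
    have h1 : fc w k = fourierCoeff (fun x => (((W x).re : ℝ) : ℂ)) k := by
      refine congrFun (fourierCoeff_congr_ae ?_) k
      filter_upwards [Complex.reCLM.coeFn_compLpL (p := 2) (μ := haar) W] with x hx
      rw [hw, hx]
      rfl
    rw [h1, fourierCoeff_re hint, hWk, hWk, fc_neg]
    simp
  refine ⟨w, Subtype.ext ?_⟩
  change res w = H1.toL2 v
  refine fc_ext fun k => ?_
  rw [fc_res, hwk, symb, inv_mul_cancel_left₀ (one_add_I_mul_ne_zero k)]

/-! ### Classical derivatives, the adjoint `(1 - ∂ₓ)⁻¹`, and unique continuation -/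

/-- The function `q` on the torus is the classical derivative of `p`. -/
def HasTorusDeriv {E : Type*} [NormedAddCommGroup E] [NormedSpace ℝ E] (p q : Torus → E) : Prop :=
  ∀ x : ℝ, HasDerivAt (fun y : ℝ => p y) (q x) x

section Classical

variable {E : Type*} [NormedAddCommGroup E] [NormedSpace ℝ E]

theorem integral_haar_eq (g : Torus → E) :
    ∫ x, g x ∂haar = (2 * π)⁻¹ • ∫ x in (0 : ℝ)..(2 * π), g x := by
  rw [AddCircle.integral_haarAddCircle, ← AddCircle.intervalIntegral_preimage (2 * π) 0 g, zero_add]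

theorem HasTorusDeriv.integral_eq_zero [CompleteSpace E] {p q : Torus → E}
    (h : HasTorusDeriv p q) (hq : Continuous q) : ∫ x, q x ∂haar = 0 := by
  rw [integral_haar_eq, intervalIntegral.integral_eq_sub_of_hasDerivAt (fun x _ => h x)
    ((hq.comp (AddCircle.continuous_mk' (2 * π))).intervalIntegrable _ _)]
  have : ((2 * π : ℝ) : Torus) = ((0 : ℝ) : Torus) := by
    rw [AddCircle.coe_period, AddCircle.coe_zero]
  simp [this]

end Classical

theorem inner_ofC (p q : C(Torus, ℝ)) : ⟪ofC p, ofC q⟫_ℝ = ∫ x, p x * q x ∂haar := by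
  rw [L2.inner_def]
  refine integral_congr_ae ?_
  filter_upwards [ofC_coe p, ofC_coe q] with x hp hq
  rw [hp, hq]
  simp [mul_comm]

theorem ofC_injective : Function.Injective ofC := ContinuousMap.toLp_injective haar

theorem denseRange_ofC : DenseRange ofC :=
  ContinuousMap.toLp_denseRange ℝ haar ℝ (by norm_num)

theorem HasTorusDeriv.inner_add_inner {p q r s : C(Torus, ℝ)} (h : HasTorusDeriv p q)
    (h' : HasTorusDeriv r s) : ⟪ofC p, ofC s⟫_ℝ + ⟪ofC q, ofC r⟫_ℝ = 0 := by
  rw [inner_ofC, inner_ofC]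
  refine (integral_add (integrable_of_continuousMap (p * s))
    (integrable_of_continuousMap (q * r))).symm.trans ?_
  have h2 : HasTorusDeriv (p * r) (p * s + q * r : C(Torus, ℝ)) := by
    intro x
    refine ((h x).fun_mul (h' x)).congr_deriv ?_
    simp [add_comm]
  exact h2.integral_eq_zero (map_continuous _)

theorem HasTorusDeriv.fc_eq {p q : C(Torus, ℝ)} (h : HasTorusDeriv p q) (k : ℤ) :
    fc (ofC q) k = Complex.I * k * fc (ofC p) k := by
  rw [fc_ofC, fc_ofC]
  set P : C(Torus, ℂ) := ⟨fun x => ((p x : ℝ) : ℂ), by fun_prop⟩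
  set Q : C(Torus, ℂ) := ⟨fun x => ((q x : ℝ) : ℂ), by fun_prop⟩
  have h2 : HasTorusDeriv (fun x => (fourier (-k) : C(Torus, ℂ)) x * P x)
      ((fourier (-k) * Q - (Complex.I * k) • (fourier (-k) * P) : C(Torus, ℂ))) := by
    intro x
    refine ((hasDerivAt_fourier_neg (2 * π) k x).fun_mul (h x).ofReal_comp).congr_deriv ?_
    have : (π : ℂ) ≠ 0 := by exact_mod_cast Real.pi_ne_zero
    simp [P, Q]
    field_simp
    ring
  have h3 := h2.integral_eq_zero (map_continuous _)
  have h4 : ∫ x, (fourier (-k) * Q - (Complex.I * k) • (fourier (-k) * P) : C(Torus, ℂ)) x ∂haar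
      = (∫ x, (fourier (-k) * Q : C(Torus, ℂ)) x ∂haar)
        - ∫ x, ((Complex.I * k) • (fourier (-k) * P) : C(Torus, ℂ)) x ∂haar :=
    integral_sub (integrable_of_continuousMap _) (integrable_of_continuousMap _)
  rw [h4, sub_eq_zero] at h3
  change ∫ x, (fourier (-k) * Q : C(Torus, ℂ)) x ∂haar = _
  rw [h3]
  exact integral_const_mul _ _

theorem HasTorusDeriv.res_ofC {p q : C(Torus, ℝ)} (h : HasTorusDeriv p q) :
    res (ofC (p + q)) = ofC p := by
  refine fc_ext fun k => ?_
  rw [fc_res, map_add, fc_add, h.fc_eq, symb]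
  rw [inv_mul_eq_iff_eq_mul₀ (one_add_I_mul_ne_zero k)]
  ring

theorem HasTorusDeriv.resC_ofC {p q : C(Torus, ℝ)} (h : HasTorusDeriv p q) :
    resC (ofC (p + q)) = p :=
  ofC_injective h.res_ofC

theorem exists_continuousMap_of_periodic {g : ℝ → ℝ} (hg : Continuous g)
    (hp : Function.Periodic g (2 * π)) : ∃ p : C(Torus, ℝ), ∀ x : ℝ, p x = g x :=
  ⟨⟨hp.lift, (QuotientAddGroup.isQuotientMap_mk _).continuous_iff.2 hg⟩, fun _ => rfl⟩

/-- Solves `p + p' = h` by variation of constants. Together with `denseRange_ofC` it lets identities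
in `L²` be checked on classical functions only. -/
theorem exists_hasTorusDeriv_add (h : C(Torus, ℝ)) :
    ∃ p q : C(Torus, ℝ), HasTorusDeriv p q ∧ p + q = h := by
  set H : ℝ → ℝ := fun x => Real.exp x * h x with hH
  have hHc : Continuous H := by
    have : Continuous fun x : ℝ => h (x : Torus) :=
      (map_continuous h).comp (AddCircle.continuous_mk' (2 * π))
    fun_prop
  -- The one initial value for which `P (2π) = P 0`.
  set c : ℝ := (∫ y in (0 : ℝ)..(2 * π), H y) / (Real.exp (2 * π) - 1) with hc
  set P : ℝ → ℝ := fun x => Real.exp (-x) * (c + ∫ y in (0 : ℝ)..x, H y) with hP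
  have hPd : ∀ x : ℝ, HasDerivAt P (h x - P x) x := by
    intro x
    have h1 : HasDerivAt (fun x => ∫ y in (0 : ℝ)..x, H y) (H x) x :=
      intervalIntegral.integral_hasDerivAt_right (hHc.intervalIntegrable _ _)
        (hHc.stronglyMeasurableAtFilter _ _) hHc.continuousAt
    refine ((hasDerivAt_neg x).exp.fun_mul (h1.const_add c)).congr_deriv ?_
    simp only [hP, hH]
    rw [← mul_assoc (Real.exp (-x)) (Real.exp x), ← Real.exp_add]
    simp
    ring
  have hPc : Continuous P := continuous_iff_continuousAt.2 fun x => (hPd x).continuousAt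
  have hper : Function.Periodic P (2 * π) := by
    set D : ℝ → ℝ := fun x => Real.exp x * (P (x + 2 * π) - P x) with hD
    have hDd : ∀ x, HasDerivAt D 0 x := by
      intro x
      have h1 := (hPd (x + 2 * π)).comp_add_const x (2 * π)
      refine ((Real.hasDerivAt_exp x).fun_mul (h1.fun_sub (hPd x))).congr_deriv ?_
      have : ((x + 2 * π : ℝ) : Torus) = (x : Torus) := AddCircle.coe_add_period _ _
      rw [this]
      ring
    have hD0 : D 0 = 0 := by
      have he : Real.exp (2 * π) - 1 ≠ 0 :=
        (sub_pos.2 (Real.one_lt_exp_iff.2 Real.two_pi_pos)).ne'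
      have hI : ∫ y in (0 : ℝ)..(2 * π), H y = c * (Real.exp (2 * π) - 1) := by
        rw [hc, div_mul_cancel₀ _ he]
      simp only [hD, hP, zero_add, hI, intervalIntegral.integral_same, Real.exp_zero,
        Real.exp_neg]
      field_simp
      ring
    intro x
    have h1 : D x = D 0 := is_const_of_deriv_eq_zero (fun x => (hDd x).differentiableAt)
      (fun x => (hDd x).deriv) x 0
    rw [hD0] at h1
    exact sub_eq_zero.1 ((mul_eq_zero.1 h1).resolve_left (Real.exp_ne_zero x))
  obtain ⟨p, hp⟩ := exists_continuousMap_of_periodic hPc hper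
  refine ⟨p, h - p, fun x => ?_, by simp⟩
  simp only [hp, ContinuousMap.sub_apply]
  exact hPd x

theorem exists_hasTorusDeriv_sub (h : C(Torus, ℝ)) :
    ∃ p q : C(Torus, ℝ), HasTorusDeriv p q ∧ p - q = h := by
  set n : C(Torus, Torus) := ⟨fun x => -x, continuous_neg⟩
  obtain ⟨p, q, hpq, hh⟩ := exists_hasTorusDeriv_add (h.comp n)
  refine ⟨p.comp n, -(q.comp n), fun x => ?_, ?_⟩
  · have h1 := (hpq (-x)).comp x (hasDerivAt_neg x)
    simpa [n, Function.comp_def] using h1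
  · ext x
    have := congrArg (fun g : C(Torus, ℝ) => g (-x)) hh
    simpa [n] using this

/-- The adjoint operator `(1 - ∂ₓ)⁻¹` on `L²`. -/
def resAdj : L2 →L[ℝ] L2 := ContinuousLinearMap.adjoint res

theorem inner_resAdj_left (u v : L2) : ⟪resAdj u, v⟫_ℝ = ⟪u, res v⟫_ℝ :=
  ContinuousLinearMap.adjoint_inner_left res v u

theorem inner_resAdj_right (u v : L2) : ⟪u, resAdj v⟫_ℝ = ⟪res u, v⟫_ℝ :=
  ContinuousLinearMap.adjoint_inner_right res u v

/-- Integration by parts against the dense set of functions `r + r'`. -/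
theorem HasTorusDeriv.resAdj_ofC {p q : C(Torus, ℝ)} (h : HasTorusDeriv p q) :
    resAdj (ofC (p - q)) = ofC p := by
  refine ext_inner_right ℝ fun w => ?_
  rw [inner_resAdj_left]
  refine congrFun (denseRange_ofC.equalizer (f := ofC)
    (g := fun w => ⟪ofC (p - q), res w⟫_ℝ) (h := fun w => ⟪ofC p, w⟫_ℝ)
    (by fun_prop) (by fun_prop) ?_) w
  funext g
  obtain ⟨r, s, hrs, rfl⟩ := exists_hasTorusDeriv_add g
  have := h.inner_add_inner hrs
  simp only [Function.comp_apply, hrs.res_ofC]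
  rw [map_add, map_sub, inner_add_right, inner_sub_left]
  linarith

theorem eq_zero_of_res_eq_zero {w : L2} (h : res w = 0) : w = 0 := by
  refine fc_injective fun k => ?_
  have h1 := fc_res w k
  have h0 : fc (0 : L2) k = 0 := map_zero (fcL k)
  rw [h, h0] at h1
  exact (mul_eq_zero.1 h1.symm).resolve_left (inv_ne_zero (one_add_I_mul_ne_zero k))

/-- The orthogonal complement of the range of an adjoint is the kernel of the operator, here zero.
-/
theorem denseRange_resAdj : DenseRange resAdj := by
  change Dense (LinearMap.range (resAdj : L2 →ₗ[ℝ] L2) : Set L2)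
  rw [Submodule.dense_iff_topologicalClosure_eq_top, Submodule.topologicalClosure_eq_top_iff,
    Submodule.eq_bot_iff]
  intro w hw
  apply eq_zero_of_res_eq_zero
  refine ext_inner_left ℝ fun v => ?_
  rw [inner_zero_right, ← inner_resAdj_left]
  exact (Submodule.mem_orthogonal _ _).1 hw _ ⟨v, rfl⟩

/-- With `u = (1 + ∂ₓ)⁻¹w` the left factor is `uₓ`, and `uₓ f(u)` is the derivative of a primitive
of `f` composed with `u`. This is exact for classical `u` and extends by density. -/
theorem inner_sub_res_comp_eq_zero (f : C(ℝ, ℝ)) (w : L2) :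
    ⟪w - res w, ofC (f.comp (resC w))⟫_ℝ = 0 := by
  have hc : Continuous fun w => ofC (f.comp (resC w)) :=
    ofC.continuous.comp ((ContinuousMap.continuous_postcomp f).comp resC.continuous)
  refine congrFun (denseRange_ofC.equalizer (f := ofC)
    (g := fun w => ⟪w - res w, ofC (f.comp (resC w))⟫_ℝ) (h := fun _ => 0)
    (by fun_prop) (by fun_prop) ?_) w
  funext g
  obtain ⟨r, s, hrs, rfl⟩ := exists_hasTorusDeriv_add g
  simp only [Function.comp_apply, hrs.res_ofC, hrs.resC_ofC]
  rw [map_add, add_sub_cancel_left, inner_ofC]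
  have h : HasTorusDeriv (fun x => ∫ y in (0 : ℝ)..(r x), f y) (s * f.comp r : C(Torus, ℝ)) := by
    intro x
    have h1 : HasDerivAt (fun z => ∫ y in (0 : ℝ)..z, f y) (f (r x)) (r x) :=
      intervalIntegral.integral_hasDerivAt_right ((map_continuous f).intervalIntegrable _ _)
        ((map_continuous f).stronglyMeasurableAtFilter _ _) (map_continuous f).continuousAt
    have h2 := h1.comp x (hrs x)
    simpa [Function.comp_def, mul_comm] using h2
  exact h.integral_eq_zero (map_continuous _)

/-- Let `p = (1 - ∂ₓ)⁻¹h` and `r = (1 + ∂ₓ)⁻¹p`. Then `(1 + ∂ₓ)⁻¹(h - p) = -r'`, so `r' = 0` on the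
open set where `a ≠ 0`. There `p = r`, hence `p' = 0`, and `h = 0` gives `p = 0`. Since `(e^{-x}p)'
= -e^{-x}h ≤ 0`, the function `e^{-x}p` is monotone, and it vanishes at both ends of a period: `p`,
and with it `h`, is zero. -/
theorem eq_zero_of_mul_resC_eq_zero {a h : C(Torus, ℝ)} (hh : ∀ x, 0 ≤ h x)
    (ha : ∃ x, a x ≠ 0) (hah : ∀ x, a x ≠ 0 → h x = 0)
    (hres : a * resC (ofC h - resAdj (ofC h)) = 0) : h = 0 := by
  obtain ⟨p, q, hpq, hsub⟩ := exists_hasTorusDeriv_sub h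
  obtain ⟨r, s, hrs, hadd⟩ := exists_hasTorusDeriv_add p
  have h1 : resC (ofC h - resAdj (ofC h)) = -s := by
    have e1 : resC (ofC p) = r := by rw [← hadd]; exact hrs.resC_ofC
    have e2 := hpq.resC_ofC
    rw [map_add, map_add, e1] at e2
    have e3 : resAdj (ofC h) = ofC p := by rw [← hsub]; exact hpq.resAdj_ofC
    rw [e3, map_sub, ← hsub, map_sub, map_sub, sub_sub_cancel_left, neg_inj]
    rw [eq_sub_of_add_eq' e2, ← hadd, add_sub_cancel_left]
  have hs : ∀ x, a x ≠ 0 → s x = 0 := by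
    intro x hx
    have := congrArg (fun g : C(Torus, ℝ) => g x) hres
    rw [h1] at this
    simpa [hx] using this
  obtain ⟨z, hz⟩ := ha
  obtain ⟨x₀, rfl⟩ := QuotientAddGroup.mk_surjective z
  have hnear : ∀ᶠ x : ℝ in 𝓝 x₀, a (x : Torus) ≠ 0 :=
    ((map_continuous a).comp (AddCircle.continuous_mk' (2 * π))).continuousAt.eventually_ne hz
  -- Equality on a neighbourhood, not only at the point, is what allows the derivatives to be
  -- compared.
  have hpr : (fun x : ℝ => p (x : Torus)) =ᶠ[𝓝 x₀] fun x : ℝ => r (x : Torus) := by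
    filter_upwards [hnear] with x hx
    rw [← hadd]
    simp [hs _ hx]
  have hp0 : p (x₀ : Torus) = 0 := by
    have hq : q (x₀ : Torus) = s (x₀ : Torus) :=
      ((hpq x₀).congr_of_eventuallyEq hpr.symm).unique (hrs x₀)
    have hpqh := congrArg (fun g : C(Torus, ℝ) => g x₀) hsub
    simp only [ContinuousMap.sub_apply] at hpqh
    have e1 := hs _ hz
    have e2 := hah _ hz
    change s (x₀ : Torus) = 0 at e1
    change h (x₀ : Torus) = 0 at e2
    linarith
  set G : ℝ → ℝ := fun x => Real.exp (-x) * p (x : Torus) with hG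
  have hGd : ∀ x : ℝ, HasDerivAt G (-(Real.exp (-x) * h x)) x := by
    intro x
    refine ((hasDerivAt_neg x).exp.fun_mul (hpq x)).congr_deriv ?_
    rw [← hsub, ContinuousMap.sub_apply]
    ring
  have hGanti : Antitone G := antitone_of_hasDerivAt_nonpos hGd fun x => by
    have := mul_nonneg (Real.exp_pos (-x)).le (hh x)
    simpa using this
  have hp : p = 0 := by
    ext z
    obtain ⟨x, hx, rfl⟩ : z ∈ ((↑) : ℝ → Torus) '' Icc x₀ (x₀ + 2 * π) := by
      rw [AddCircle.coe_image_Icc_eq]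
      trivial
    have e1 : G x ≤ 0 := by
      refine (hGanti hx.1).trans_eq ?_
      simp [hG, hp0]
    have e2 : 0 ≤ G x := by
      refine Eq.trans_le ?_ (hGanti hx.2)
      have : ((x₀ + 2 * π : ℝ) : Torus) = (x₀ : Torus) := AddCircle.coe_add_period _ _
      simp only [hG, this, hp0, mul_zero]
    have e3 := le_antisymm e1 e2
    exact (mul_eq_zero.1 e3).resolve_left (Real.exp_ne_zero _)
  have hq : q = 0 := by
    ext z
    obtain ⟨x, rfl⟩ := QuotientAddGroup.mk_surjective z
    have := hpq x
    rw [hp] at this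
    exact this.unique (hasDerivAt_const x (0 : ℝ))
  rw [← hsub, hp, hq, sub_zero]

/-! ### The vector field in the variable `w`: Lipschitz bounds and energy identity -/

section Nonlinearity

theorem exists_lipschitzOnWith_comp {f : C(ℝ, ℝ)} (hf : ContDiff ℝ 1 f) (r : ℝ) :
    ∃ K : NNReal, LipschitzOnWith K (fun p : C(Torus, ℝ) => f.comp p) (Metric.closedBall 0 r) := by
  obtain ⟨K, hK⟩ := hf.contDiffOn.exists_lipschitzOnWith (s := Metric.closedBall (0 : ℝ) r)
    one_ne_zero (convex_closedBall 0 r) (isCompact_closedBall 0 r)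
  refine ⟨K, LipschitzOnWith.of_dist_le_mul fun p hp q hq => ?_⟩
  rw [ContinuousMap.dist_le (by positivity)]
  intro x
  have hmem : ∀ g ∈ Metric.closedBall (0 : C(Torus, ℝ)) r, g x ∈ Metric.closedBall (0 : ℝ) r := by
    intro g hg
    rw [mem_closedBall_zero_iff] at hg ⊢
    exact (g.norm_coe_le_norm x).trans hg
  refine (hK.dist_le_mul _ (hmem p hp) _ (hmem q hq)).trans ?_
  gcongr
  exact ContinuousMap.dist_apply_le_dist x

variable (f : C(ℝ, ℝ)) (a : C(Torus, ℝ))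

/-- The map `w ↦ f((1 + ∂ₓ)⁻¹ w)`. -/
def nonlin (w : L2) : L2 := ofC (f.comp (resC w))

/-- The map `w ↦ a (1 + ∂ₓ)⁻¹ w`. -/
def damp : L2 →L[ℝ] L2 := ofC.comp ((ContinuousLinearMap.mul ℝ C(Torus, ℝ) a).comp resC)

theorem damp_apply (w : L2) : damp a w = ofC (a * resC w) := rfl

/-- The vector field of the equation in the variable `w = (1 + ∂ₓ) u`. -/
def field (w : L2) : L2 := nonlin f w - resAdj (nonlin f w + damp a w)

theorem continuous_nonlin : Continuous (nonlin f) :=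
  ofC.continuous.comp ((ContinuousMap.continuous_postcomp f).comp resC.continuous)

variable {f a}

theorem exists_lipschitzOnWith_nonlin (hf : ContDiff ℝ 1 f) (r : ℝ) :
    ∃ K : NNReal, LipschitzOnWith K (nonlin f) (Metric.closedBall 0 r) := by
  obtain ⟨K, hK⟩ := exists_lipschitzOnWith_comp hf (‖resC‖ * r)
  refine ⟨_, ofC.lipschitz.comp_lipschitzOnWith
    (hK.comp (resC.lipschitz.lipschitzOnWith (s := Metric.closedBall 0 r)) fun w hw => ?_)⟩
  rw [mem_closedBall_zero_iff] at hw ⊢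
  exact (resC.le_opNorm w).trans (by gcongr)

theorem exists_lipschitzOnWith_field (hf : ContDiff ℝ 1 f) (r : ℝ) :
    ∃ K : NNReal, LipschitzOnWith K (field f a) (Metric.closedBall 0 r) := by
  obtain ⟨K, hK⟩ := exists_lipschitzOnWith_nonlin hf r
  exact ⟨_, hK.sub (resAdj.lipschitz.comp_lipschitzOnWith
    (hK.add (damp a).lipschitz.lipschitzOnWith))⟩

/-- Moving the adjoint across turns the terms in `f` into `⟪w - res w, f(u)⟫`, which vanishes; only
the damping remains. -/
theorem inner_field (w : L2) : ⟪w, field f a w⟫_ℝ = -⟪res w, damp a w⟫_ℝ := by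
  have h := inner_sub_res_comp_eq_zero f w
  change ⟪w - res w, nonlin f w⟫_ℝ = 0 at h
  rw [inner_sub_left] at h
  rw [field, inner_sub_right, inner_resAdj_right, inner_add_right]
  linarith

theorem inner_res_damp (w : L2) :
    ⟪res w, damp a w⟫_ℝ = ∫ x, a x * resC w x ^ 2 ∂haar := by
  rw [res_apply, damp_apply, inner_ofC]
  congr 1
  ext x
  simp only [ContinuousMap.mul_apply]
  ring

theorem inner_res_damp_nonneg (ha : ∀ x, 0 ≤ a x) (w : L2) : 0 ≤ ⟪res w, damp a w⟫_ℝ := by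
  rw [inner_res_damp]
  exact integral_nonneg fun x => mul_nonneg (ha x) (sq_nonneg _)

/-- Pointwise `a² u² ≤ ‖a‖ a u²`, so the dissipation controls `a u` in `L²`. -/
theorem norm_damp_sq_le (ha : ∀ x, 0 ≤ a x) (w : L2) :
    ‖damp a w‖ ^ 2 ≤ ‖a‖ * ⟪res w, damp a w⟫_ℝ := by
  have i1 : Integrable (fun x => a x * resC w x ^ 2) haar :=
    Continuous.integrable_of_hasCompactSupport (by fun_prop) (HasCompactSupport.of_compactSpace _)
  have i2 : Integrable (fun x => (a * resC w) x * (a * resC w) x) haar :=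
    Continuous.integrable_of_hasCompactSupport (by fun_prop) (HasCompactSupport.of_compactSpace _)
  rw [← real_inner_self_eq_norm_sq, inner_res_damp, damp_apply, inner_ofC, ← integral_const_mul]
  refine integral_mono i2 (i1.const_mul ‖a‖) fun x => ?_
  have h1 : a x ≤ ‖a‖ := (le_abs_self _).trans (a.norm_coe_le_norm x)
  have h2 : 0 ≤ a x * resC w x ^ 2 := mul_nonneg (ha x) (sq_nonneg _)
  simp only [ContinuousMap.mul_apply]
  nlinarith

end Nonlinearity

/-! ### Global solutions of dissipative, locally Lipschitz ODEs -/

section ODE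

variable {E : Type*} [NormedAddCommGroup E] [InnerProductSpace ℝ E]

theorem antitoneOn_norm_of_inner_nonpos {Φ : E → E} {w : ℝ → E} {D : Set ℝ} (hD : Convex ℝ D)
    (hw : ∀ t ∈ D, HasDerivWithinAt w (Φ (w t)) D t) (hΦ : ∀ v, ⟪v, Φ v⟫_ℝ ≤ 0) :
    AntitoneOn (fun t => ‖w t‖ ^ 2) D := by
  refine antitoneOn_of_hasDerivWithinAt_nonpos (f' := fun t => 2 * ⟪w t, Φ (w t)⟫_ℝ) hD
    (fun t ht => (hw t ht).norm_sq.continuousWithinAt)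
    (fun t ht => ((hw t (interior_subset ht)).norm_sq).mono interior_subset) fun t _ => ?_
  have := hΦ (w t)
  linarith

variable {Φ : E → E}

/-- Multiplying the field by a radial cutoff makes it globally bounded, so Picard–Lindelöf covers
all of `[0, T]` at once. The cut-off field is still dissipative, so the solution stays in the ball
where the cutoff equals `1`. -/
theorem exists_solution_Icc [CompleteSpace E]
    (hlip : ∀ r, ∃ K : NNReal, LipschitzOnWith K Φ (Metric.closedBall 0 r))
    (hΦ : ∀ v, ⟪v, Φ v⟫_ℝ ≤ 0) (w₀ : E) {T : ℝ} (hT : 0 ≤ T) :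
    ∃ w : ℝ → E, w 0 = w₀ ∧ ∀ t ∈ Icc 0 T, HasDerivWithinAt w (Φ (w t)) (Icc 0 T) t := by
  -- Equal to `1` for `‖v‖ ≤ ‖w₀‖`, to `0` for `‖v‖ ≥ ‖w₀‖ + 1`, and `1`-Lipschitz.
  set χ : E → ℝ := fun v => max 0 (min 1 (‖w₀‖ + 1 - ‖v‖)) with hχ
  have hχ0 : ∀ v, 0 ≤ χ v := fun v => le_max_left _ _
  have hχ1 : ∀ v, χ v ≤ 1 := fun v => max_le zero_le_one (min_le_left _ _)
  have hχlip : ∀ v v', |χ v - χ v'| ≤ ‖v - v'‖ := by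
    intro v v'
    refine (abs_max_sub_max_le_max _ _ _ _).trans ?_
    rw [sub_self, abs_zero]
    refine max_le (norm_nonneg _) ((abs_min_sub_min_le_max _ _ _ _).trans ?_)
    rw [sub_self, abs_zero]
    refine max_le (norm_nonneg _) ?_
    rw [sub_sub_sub_cancel_left, abs_sub_comm]
    exact abs_norm_sub_norm_le v v'
  have hbdd : ∀ r, ∃ M : NNReal, ∀ v ∈ Metric.closedBall (0 : E) r, ‖Φ v‖ ≤ M := by
    intro r
    obtain ⟨K, hK⟩ := hlip (max r 0)
    refine ⟨‖Φ 0‖₊ + K * ⟨max r 0, le_max_right _ _⟩, fun v hv => ?_⟩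
    have hv' : v ∈ Metric.closedBall (0 : E) (max r 0) :=
      Metric.closedBall_subset_closedBall (le_max_left _ _) hv
    have h1 := hK.dist_le_mul v hv' 0 (Metric.mem_closedBall_self (le_max_right _ _))
    rw [dist_eq_norm, dist_zero_right] at h1
    have h2 : ‖Φ v‖ ≤ ‖Φ 0‖ + ‖Φ v - Φ 0‖ := norm_le_norm_add_norm_sub' _ _
    rw [mem_closedBall_zero_iff] at hv'
    push_cast
    refine h2.trans (add_le_add le_rfl (h1.trans ?_))
    exact mul_le_mul_of_nonneg_left hv' K.2
  obtain ⟨M, hM⟩ := hbdd (‖w₀‖ + 1)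
  have hcut : ∀ v, ‖χ v • Φ v‖ ≤ M := by
    intro v
    rw [norm_smul, Real.norm_of_nonneg (hχ0 v)]
    by_cases hv : ‖v‖ ≤ ‖w₀‖ + 1
    · exact (mul_le_of_le_one_left (norm_nonneg _) (hχ1 v)).trans
        (hM v (mem_closedBall_zero_iff.2 hv))
    · have : χ v = 0 := max_eq_left ((min_le_right _ _).trans (by linarith))
      simp [this]
  -- A curve of speed at most `M` travels at most `M T` in time `T`.
  set R : NNReal := M * ⟨T, hT⟩ with hR
  obtain ⟨K, hK⟩ := hlip (‖w₀‖ + R)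
  obtain ⟨N, hN⟩ := hbdd (‖w₀‖ + R)
  have hsub : Metric.closedBall w₀ (R : ℝ) ⊆ Metric.closedBall 0 (‖w₀‖ + R) := by
    refine Metric.closedBall_subset_closedBall' ?_
    rw [dist_zero_right, add_comm]
  have hPL : IsPicardLindelof (fun _ v => χ v • Φ v) (⟨0, left_mem_Icc.2 hT⟩ : Icc 0 T) w₀ R 0 M
      (K + N) := by
    refine ⟨fun t _ => LipschitzOnWith.of_dist_le_mul fun v hv v' hv' => ?_,
      fun v _ => continuousOn_const, fun t _ v _ => hcut v, ?_⟩
    · have e : χ v • Φ v - χ v' • Φ v' = χ v • (Φ v - Φ v') + (χ v - χ v') • Φ v' := by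
        rw [smul_sub, sub_smul]; abel
      rw [dist_eq_norm, e, NNReal.coe_add, add_mul]
      refine (norm_add_le _ _).trans (add_le_add ?_ ?_)
      · rw [norm_smul, Real.norm_of_nonneg (hχ0 v), ← dist_eq_norm]
        exact (mul_le_of_le_one_left dist_nonneg (hχ1 v)).trans
          (hK.dist_le_mul v (hsub hv) v' (hsub hv'))
      · rw [norm_smul, mul_comm, dist_eq_norm]
        exact mul_le_mul (hN v' (hsub hv')) (hχlip v v') (abs_nonneg _) N.2
    · simp only [hR, sub_zero, sub_self, max_eq_left hT, NNReal.coe_zero]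
      exact le_rfl
  obtain ⟨w, hw0, hw⟩ := hPL.exists_eq_forall_mem_Icc_hasDerivWithinAt₀
  have hanti := antitoneOn_norm_of_inner_nonpos (Φ := fun v => χ v • Φ v)
    (convex_Icc 0 T) hw (fun v => by
    rw [real_inner_smul_right]
    exact mul_nonpos_of_nonneg_of_nonpos (hχ0 v) (hΦ v))
  refine ⟨w, hw0, fun t ht => ?_⟩
  have h1 : ‖w t‖ ≤ ‖w₀‖ := by
    have := hanti (left_mem_Icc.2 hT) ht ht.1
    simp only at hw0
    simp only [hw0] at this
    exact (pow_le_pow_iff_left₀ (norm_nonneg _) (norm_nonneg _) two_ne_zero).1 this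
  have h2 : χ (w t) = 1 := by
    rw [hχ]
    simp only
    rw [min_eq_left (by linarith), max_eq_right zero_le_one]
  simpa [h2] using hw t ht

theorem eqOn_of_solution_Icc
    (hlip : ∀ r, ∃ K : NNReal, LipschitzOnWith K Φ (Metric.closedBall 0 r))
    {T : ℝ} {w v : ℝ → E}
    (hw : ∀ t ∈ Icc 0 T, HasDerivWithinAt w (Φ (w t)) (Icc 0 T) t)
    (hv : ∀ t ∈ Icc 0 T, HasDerivWithinAt v (Φ (v t)) (Icc 0 T) t) (h0 : w 0 = v 0) :
    EqOn w v (Icc 0 T) := by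
  have hwc : ContinuousOn w (Icc 0 T) := fun t ht => (hw t ht).continuousWithinAt
  have hvc : ContinuousOn v (Icc 0 T) := fun t ht => (hv t ht).continuousWithinAt
  obtain ⟨R₁, hR₁⟩ := (isCompact_Icc.image_of_continuousOn hwc).isBounded.subset_closedBall 0
  obtain ⟨R₂, hR₂⟩ := (isCompact_Icc.image_of_continuousOn hvc).isBounded.subset_closedBall 0
  obtain ⟨K, hK⟩ := hlip (max R₁ R₂)
  have hIci : ∀ t ∈ Ico (0 : ℝ) T, Icc 0 T ∈ 𝓝[Ici t] t := fun t ht =>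
    mem_of_superset (Icc_mem_nhdsGE ht.2) (Icc_subset_Icc_left ht.1)
  refine ODE_solution_unique_of_mem_Icc_right (v := fun _ => Φ)
    (s := fun _ => Metric.closedBall 0 (max R₁ R₂)) (fun _ _ => hK) hwc
    (fun t ht => (hw t (Ico_subset_Icc_self ht)).mono_of_mem_nhdsWithin (hIci t ht))
    (fun t ht => Metric.closedBall_subset_closedBall (le_max_left _ _)
      (hR₁ (mem_image_of_mem w (Ico_subset_Icc_self ht)))) hvc
    (fun t ht => (hv t (Ico_subset_Icc_self ht)).mono_of_mem_nhdsWithin (hIci t ht))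
    (fun t ht => Metric.closedBall_subset_closedBall (le_max_right _ _)
      (hR₂ (mem_image_of_mem v (Ico_subset_Icc_self ht)))) h0

theorem exists_solution_Ici [CompleteSpace E]
    (hlip : ∀ r, ∃ K : NNReal, LipschitzOnWith K Φ (Metric.closedBall 0 r))
    (hΦ : ∀ v, ⟪v, Φ v⟫_ℝ ≤ 0) (w₀ : E) :
    ∃ w : ℝ → E, w 0 = w₀ ∧ ∀ t ∈ Ici (0 : ℝ), HasDerivWithinAt w (Φ (w t)) (Ici 0) t := by
  choose w hw0 hw using fun n : ℕ => exists_solution_Icc hlip hΦ w₀ (Nat.cast_nonneg (α := ℝ) n)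
  have hle : ∀ m n : ℕ, m ≤ n → EqOn (w m) (w n) (Icc 0 m) := by
    intro m n hmn
    have hsub : Icc (0 : ℝ) m ⊆ Icc 0 n := Icc_subset_Icc_right (Nat.cast_le.2 hmn)
    exact eqOn_of_solution_Icc hlip (hw m) (fun t ht => (hw n t (hsub ht)).mono hsub)
      ((hw0 m).trans (hw0 n).symm)
  set W : ℝ → E := fun t => w ⌈t⌉₊ t with hW
  have hWn : ∀ n : ℕ, EqOn W (w n) (Icc 0 n) := fun n t ht =>
    hle _ n (Nat.ceil_le.2 ht.2) ⟨ht.1, Nat.le_ceil t⟩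
  refine ⟨W, by simp [hW, hw0], fun t ht => ?_⟩
  -- The extra `1` gives `t < n`, so that `Icc 0 n` is a neighbourhood of `t` within `Ici 0`.
  set n : ℕ := ⌈t⌉₊ + 1
  have htn : t < n := (Nat.le_ceil t).trans_lt (by simp [n])
  have htm : t ∈ Icc (0 : ℝ) n := ⟨ht, htn.le⟩
  have h1 : HasDerivWithinAt W (Φ (W t)) (Icc 0 n) t := by
    rw [hWn n htm]
    exact (hw n t htm).congr (hWn n) (hWn n htm)
  refine h1.mono_of_mem_nhdsWithin ?_
  filter_upwards [self_mem_nhdsWithin, mem_nhdsWithin_of_mem_nhds (Iio_mem_nhds htn)] with s hs hs'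
  exact ⟨hs, le_of_lt hs'⟩

end ODE

/-! ### The du Bois-Reymond lemma in time -/

section DuBoisReymond

theorem integral_eq_intervalIntegral_of_tsupport_subset {θ h : ℝ → ℝ} {T : ℝ} (hT : 0 ≤ T)
    (hθ : tsupport θ ⊆ Ioo 0 T) : ∫ t, θ t * h t = ∫ t in (0 : ℝ)..T, θ t * h t := by
  rw [intervalIntegral.integral_of_le hT]
  refine (setIntegral_eq_integral_of_forall_compl_eq_zero fun t ht => ?_).symm
  rw [image_eq_zero_of_notMem_tsupport fun h => ht (Ioo_subset_Ioc_self (hθ h)), zero_mul]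

theorem exists_primitive_of_integral_eq_zero {ρ : ℝ → ℝ} {T : ℝ} {K : Set ℝ}
    (hρ : ContDiff ℝ ∞ ρ) (hK : IsCompact K) (hK' : K ⊆ Ioo 0 T) (hne : K.Nonempty)
    (hρK : ∀ t ∉ K, ρ t = 0) (hint : ∫ t in (0 : ℝ)..T, ρ t = 0) :
    ∃ ψ : ℝ → ℝ, ContDiff ℝ ∞ ψ ∧ HasCompactSupport ψ ∧ tsupport ψ ⊆ Ioo 0 T ∧
      ∀ t, HasDerivAt ψ (ρ t) t := by
  obtain ⟨α, hα⟩ := hK.exists_isLeast hne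
  obtain ⟨β, hβ⟩ := hK.exists_isGreatest hne
  have hc : Continuous ρ := hρ.continuous
  have hd : ∀ t, HasDerivAt (fun t => ∫ s in (0 : ℝ)..t, ρ s) (ρ t) t := fun t =>
    intervalIntegral.integral_hasDerivAt_right (hc.intervalIntegrable _ _)
      (hc.stronglyMeasurableAtFilter _ _) hc.continuousAt
  have hsupp : tsupport (fun t => ∫ s in (0 : ℝ)..t, ρ s) ⊆ Icc α β := by
    refine closure_minimal (fun t ht => ?_) isClosed_Icc
    by_contra hmem
    refine ht ?_
    rw [mem_Icc, not_and_or, not_le, not_le] at hmem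
    rcases hmem with h | h
    · refine intervalIntegral.integral_zero_ae (Eventually.of_forall fun s hs => hρK s fun hsK => ?_)
      have h1 := hα.2 hsK
      have h2 : s ≤ max 0 t := (uIoc_subset_uIcc hs).2
      have h3 := (hK' hα.1).1
      exact absurd (h1.trans h2) (not_le.2 (max_lt h3 h))
    -- To the right of the support the integral is restarted from `T`, which costs nothing as `ρ`
    -- has mean zero on `[0, T]`.
    · simp only
      rw [← intervalIntegral.integral_add_adjacent_intervals (hc.intervalIntegrable 0 T)
        (hc.intervalIntegrable T t), hint, zero_add]
      refine intervalIntegral.integral_zero_ae (Eventually.of_forall fun s hs => hρK s fun hsK => ?_)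
      have h1 := hβ.2 hsK
      have h2 : min T t ≤ s := (uIoc_subset_uIcc hs).1
      have h3 := (hK' hβ.1).2
      exact absurd (h2.trans h1) (not_le.2 (lt_min h3 h))
  refine ⟨_, ?_, HasCompactSupport.of_support_subset_isCompact isCompact_Icc
    ((subset_tsupport _).trans hsupp),
    hsupp.trans (Icc_subset_Ioo (hK' hα.1).1 (hK' hβ.1).2), hd⟩
  rw [contDiff_infty_iff_deriv]
  refine ⟨fun t => (hd t).differentiableAt, ?_⟩
  rwa [funext fun t => (hd t).deriv]

/-- Subtracting `(∫ θ) χ`, where `χ` is a bump of integral `1`, turns any test function `θ` into the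
derivative of another; hence `h` equals its `χ`-average almost everywhere, and by continuity
everywhere. -/
theorem eq_of_forall_integral_deriv_mul_eq_zero {h : ℝ → ℝ} {T : ℝ} (hT : 0 < T)
    (hh : Continuous h)
    (H : ∀ ψ : ℝ → ℝ, ContDiff ℝ ∞ ψ → HasCompactSupport ψ → tsupport ψ ⊆ Ioo 0 T →
      ∫ t in (0 : ℝ)..T, deriv ψ t * h t = 0) :
    ∀ t ∈ Icc 0 T, h t = h 0 := by
  set b : ContDiffBump (T / 2) := ⟨T / 8, T / 4, by positivity, by linarith⟩
  set χ : ℝ → ℝ := b.normed volume with hχ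
  have hχs : ContDiff ℝ ∞ χ := b.contDiff_normed
  have hχc : HasCompactSupport χ := b.hasCompactSupport_normed
  have hχt : tsupport χ ⊆ Ioo 0 T := by
    rw [hχ, b.tsupport_normed_eq, Real.closedBall_eq_Icc]
    refine Icc_subset_Ioo ?_ ?_ <;> simp only [b] <;> linarith
  have hχi : ∫ t in (0 : ℝ)..T, χ t = 1 := by
    have h1 := integral_eq_intervalIntegral_of_tsupport_subset (h := fun _ => 1) hT.le hχt
    simp only [mul_one] at h1
    rw [← h1]
    exact b.integral_normed
  set c : ℝ := ∫ t in (0 : ℝ)..T, χ t * h t with hcdef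
  have hint : ∀ g : ℝ → ℝ, Continuous g → IntervalIntegrable g volume 0 T :=
    fun g hg => hg.intervalIntegrable _ _
  have hae : ∀ᵐ t, t ∈ Ioo 0 T → h t - c = 0 := by
    refine isOpen_Ioo.ae_eq_zero_of_integral_contDiff_smul_eq_zero
      ((hh.sub continuous_const).locallyIntegrable.locallyIntegrableOn _) fun θ hθ hθc hθt => ?_
    set m : ℝ := ∫ t in (0 : ℝ)..T, θ t with hm
    have hθi := hint _ hθ.continuous
    have hχi' := hint _ (hχs.continuous.const_mul m)
    obtain ⟨ψ, h1, h2, h3, h4⟩ := exists_primitive_of_integral_eq_zero (T := T)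
      (ρ := fun t => θ t - m * χ t) (K := tsupport θ ∪ tsupport χ) (by fun_prop)
      (hθc.isCompact.union hχc.isCompact) (union_subset hθt hχt)
      (Nonempty.inr (by rw [hχ, b.tsupport_normed_eq]; exact ⟨_, Metric.mem_closedBall_self (by
        simp only [b]; positivity)⟩))
      (fun t ht => by
        rw [mem_union, not_or] at ht
        rw [image_eq_zero_of_notMem_tsupport ht.1, image_eq_zero_of_notMem_tsupport ht.2]
        simp)
      (by rw [intervalIntegral.integral_sub hθi hχi', intervalIntegral.integral_const_mul, hχi]
          simp [hm])
    have h5 := H ψ h1 h2 h3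
    have hθ' : Continuous θ := hθ.continuous
    have hχ' : Continuous χ := hχs.continuous
    have i1 : IntervalIntegrable (fun t => θ t * h t) volume 0 T := hint _ (by fun_prop)
    have e : ∀ t, deriv ψ t * h t = θ t * h t - m * (χ t * h t) := fun t => by
      rw [(h4 t).deriv]; ring
    simp only [e] at h5
    rw [intervalIntegral.integral_sub i1
      (hint (fun t => m * (χ t * h t)) (by fun_prop)), intervalIntegral.integral_const_mul,
      ← hcdef] at h5
    simp only [smul_eq_mul]
    rw [integral_eq_intervalIntegral_of_tsupport_subset hT.le hθt]
    simp only [mul_sub]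
    rw [intervalIntegral.integral_sub i1 (hint (fun t => θ t * c) (by fun_prop)),
      intervalIntegral.integral_mul_const, ← hm]
    exact h5
  have hIoo : EqOn h (fun _ => c) (Ioo 0 T) := by
    have h1 : h =ᵐ[volume.restrict (Ioo 0 T)] fun _ => c := by
      rw [Filter.EventuallyEq, ae_restrict_iff' measurableSet_Ioo]
      filter_upwards [hae] with t ht ht'
      exact sub_eq_zero.1 (ht ht')
    exact Measure.eqOn_open_of_ae_eq h1 isOpen_Ioo hh.continuousOn continuousOn_const
  have hIcc : EqOn h (fun _ => c) (Icc 0 T) := by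
    rw [← closure_Ioo hT.ne]
    exact hIoo.closure hh continuous_const
  intro t ht
  rw [hIcc ht, hIcc (left_mem_Icc.2 hT.le)]

/-- Integrating `ψ k` by parts shows that `g` minus a primitive of `k` has zero distributional
derivative. -/
theorem eq_add_integral_of_weak {g k : ℝ → ℝ} {T : ℝ} (hT : 0 < T) (hg : Continuous g)
    (hk : Continuous k)
    (H : ∀ ψ : ℝ → ℝ, ContDiff ℝ ∞ ψ → HasCompactSupport ψ → tsupport ψ ⊆ Ioo 0 T →
      ∫ t in (0 : ℝ)..T, (deriv ψ t * g t + ψ t * k t) = 0) :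
    ∀ t ∈ Icc 0 T, g t = g 0 + ∫ s in (0 : ℝ)..t, k s := by
  have hd : ∀ t, HasDerivAt (fun t => ∫ s in (0 : ℝ)..t, k s) (k t) t := fun t =>
    intervalIntegral.integral_hasDerivAt_right (hk.intervalIntegrable _ _)
      (hk.stronglyMeasurableAtFilter _ _) hk.continuousAt
  have hKc : Continuous fun t => ∫ s in (0 : ℝ)..t, k s :=
    continuous_iff_continuousAt.2 fun t => (hd t).continuousAt
  have h1 := eq_of_forall_integral_deriv_mul_eq_zero hT (hg.sub hKc) fun ψ hψ hψc hψt => by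
    have hψd : Continuous (deriv ψ) := hψ.continuous_deriv (by simp)
    have hψD : ∀ t, HasDerivAt ψ (deriv ψ t) t := fun t =>
      (hψ.differentiable (by simp) t).hasDerivAt
    have e1 := intervalIntegral.integral_deriv_mul_eq_sub (a := 0) (b := T) (fun t _ => hψD t)
      (fun t _ => hd t) (hψd.intervalIntegrable _ _) (hk.intervalIntegrable _ _)
    have z : ∀ t ∉ Ioo 0 T, ψ t = 0 := fun t ht =>
      image_eq_zero_of_notMem_tsupport fun h => ht (hψt h)
    rw [z T (by simp), z 0 (by simp), zero_mul, zero_mul, sub_zero] at e1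
    have e2 := H ψ hψ hψc hψt
    have e3 := intervalIntegral.integral_sub
      (((hψd.mul hg).add (hψ.continuous.mul hk)).intervalIntegrable (μ := volume) 0 T)
      (((hψd.mul hKc).add (hψ.continuous.mul hk)).intervalIntegrable (μ := volume) 0 T)
    refine Eq.trans (intervalIntegral.integral_congr fun t _ => ?_)
      (e3.trans (sub_eq_zero.2 (e2.trans e1.symm)))
    simp only [Pi.sub_apply, Pi.add_apply, Pi.mul_apply]
    ring
  intro t ht
  have := h1 t ht
  simp only [Pi.sub_apply, intervalIntegral.integral_same, sub_zero] at this
  linarith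

end DuBoisReymond

/-! ### Equivalence of the distributional equation with the ODE -/

theorem SmoothOnTorus.exists_hasTorusDeriv {φ : Torus → ℝ} (hφ : SmoothOnTorus φ) :
    ∃ p q : C(Torus, ℝ), SmoothOnTorus q ∧ HasTorusDeriv p q ∧ (∀ x, p x = φ x) ∧
      ∀ x : ℝ, q x = deriv (fun y : ℝ => φ y) x := by
  have hφ' : ContDiff ℝ ∞ (fun y : ℝ => φ y) := hφ
  have hper : Function.Periodic (fun y : ℝ => φ y) (2 * π) := fun x => by
    change φ ((x + 2 * π : ℝ) : Torus) = φ (x : Torus)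
    rw [AddCircle.coe_add_period]
  have hdper : Function.Periodic (deriv fun y : ℝ => φ y) (2 * π) := fun x => by
    rw [← deriv_comp_add_const, funext hper]
  obtain ⟨p, hp⟩ := exists_continuousMap_of_periodic hφ'.continuous hper
  obtain ⟨q, hq⟩ := exists_continuousMap_of_periodic (hφ'.continuous_deriv (by simp)) hdper
  refine ⟨p, q, ?_, fun x => ?_, fun x => ?_, hq⟩
  · rw [SmoothOnTorus, funext hq]
    exact (contDiff_infty_iff_deriv.1 hφ').2
  · rw [funext hp, hq]
    exact (hφ'.differentiable (by simp) x).hasDerivAt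
  · obtain ⟨y, rfl⟩ := QuotientAddGroup.mk_surjective x
    exact hp y

theorem integral_haar_eq_inner_one (p : C(Torus, ℝ)) : ∫ x, p x ∂haar = ⟪ofC p, ofC 1⟫_ℝ := by
  rw [inner_ofC]
  simp

theorem inner_ofC_mul_one (p q : C(Torus, ℝ)) : ⟪ofC (p * q), ofC 1⟫_ℝ = ⟪ofC p, ofC q⟫_ℝ := by
  rw [← integral_haar_eq_inner_one, inner_ofC]
  rfl

/-- Testing the equation with `φ` is testing the ODE with `(1 + ∂ₓ)φ`, because `(1 - ∂ₓ)⁻¹(φ - φ'')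
= φ + φ'`. The factor `2π` comes from normalizing the measure. -/
theorem weak_integral_eq (f : C(ℝ, ℝ)) (a : C(Torus, ℝ)) (w : L2) {φ : Torus → ℝ}
    (p q r : C(Torus, ℝ)) (hp : ∀ x, p x = φ x)
    (hq : ∀ x : ℝ, q x = deriv (fun y : ℝ => φ y) x)
    (hr : ∀ x : ℝ, r x = iteratedDeriv 2 (fun y : ℝ => φ y) x)
    (hpq : HasTorusDeriv p q) (hqr : HasTorusDeriv q r) (α β : ℝ) :
    ∫ x in (0 : ℝ)..(2 * π),
        (-(α * resH1 w (x : Torus) * (φ x - iteratedDeriv 2 (fun y : ℝ => φ y) x))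
          - β * f (resH1 w (x : Torus)) * deriv (fun y : ℝ => φ y) x
          + β * a x * resH1 w (x : Torus) * φ x)
      = -(2 * π) * (α * ⟪w, ofC (p + q)⟫_ℝ + β * ⟪field f a w, ofC (p + q)⟫_ℝ) := by
  obtain rfl : ⇑p = φ := funext hp
  simp only [← hq, ← hr]
  have h1 := integral_haar_eq (fun x : Torus => -(α * res w x * (p x - r x))
    - β * f (res w x) * q x + β * a x * res w x * p x)
  rw [smul_eq_mul, eq_inv_mul_iff_mul_eq₀ Real.two_pi_pos.ne'] at h1
  refine h1.symm.trans ?_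
  have h2 : ∫ x, (-(α * res w x * (p x - r x)) - β * f (res w x) * q x + β * a x * res w x * p x)
        ∂haar
      = ∫ x, (-(α • (resC w * (p - r))) - β • (f.comp (resC w) * q)
          + β • (a * resC w * p) : C(Torus, ℝ)) x ∂haar := by
    refine integral_congr_ae ?_
    filter_upwards [ofC_coe (resC w)] with x hx
    rw [res_apply, hx]
    simp only [ContinuousMap.add_apply, ContinuousMap.sub_apply, ContinuousMap.neg_apply,
      ContinuousMap.smul_apply, ContinuousMap.mul_apply, ContinuousMap.comp_apply, smul_eq_mul]
    ring
  have h3 : HasTorusDeriv (p + q : C(Torus, ℝ)) (q + r : C(Torus, ℝ)) := fun x =>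
    (hpq x).fun_add (hqr x)
  have h4 : ⟪w, ofC (p + q)⟫_ℝ = ⟪ofC (resC w), ofC (p - r)⟫_ℝ := by
    rw [← h3.resAdj_ofC, inner_resAdj_right, res_apply, add_sub_add_comm, sub_add_sub_cancel]
  have h5 : ⟪field f a w, ofC (p + q)⟫_ℝ
      = ⟪ofC (f.comp (resC w)), ofC q⟫_ℝ - ⟪ofC (a * resC w), ofC p⟫_ℝ := by
    rw [field, inner_sub_left, inner_resAdj_left, hpq.res_ofC, map_add, inner_add_right,
      inner_add_left, nonlin, damp_apply]
    ring
  rw [h2, h4, h5, integral_haar_eq_inner_one, map_add, map_sub, map_neg, map_smul, map_smul,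
    map_smul, inner_add_left, inner_sub_left, inner_neg_left, real_inner_smul_left,
    real_inner_smul_left, real_inner_smul_left, inner_ofC_mul_one, inner_ofC_mul_one,
    inner_ofC_mul_one]
  ring

theorem SmoothOnTorus.exists_jet {φ : Torus → ℝ} (hφ : SmoothOnTorus φ) :
    ∃ p q r : C(Torus, ℝ), HasTorusDeriv p q ∧ HasTorusDeriv q r ∧ (∀ x, p x = φ x) ∧
      (∀ x : ℝ, q x = deriv (fun y : ℝ => φ y) x) ∧
      ∀ x : ℝ, r x = iteratedDeriv 2 (fun y : ℝ => φ y) x := by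
  obtain ⟨p, q, hqs, hpq, hp, hq⟩ := hφ.exists_hasTorusDeriv
  obtain ⟨q', r, -, hqr, hq', hr⟩ := hqs.exists_hasTorusDeriv
  obtain rfl : q' = q := ContinuousMap.ext hq'
  refine ⟨p, q', r, hpq, hqr, hp, hq, fun x => ?_⟩
  rw [hr, funext hq, iteratedDeriv_succ, iteratedDeriv_one]

section Weak

variable {f : C(ℝ, ℝ)} {a : C(Torus, ℝ)}

theorem continuous_field : Continuous (field f a) := by
  have := continuous_nonlin f
  unfold field
  fun_prop

theorem isSolution_resH1 {w₀ : L2} {w : ℝ → L2} (h0 : w 0 = w₀)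
    (hw : ∀ t ∈ Ici (0 : ℝ), HasDerivWithinAt w (field f a (w t)) (Ici 0) t) {T : ℝ} (hT : 0 < T) :
    IsSolution f a (resH1 w₀) T fun t => resH1 (w t) := by
  have hc : ContinuousOn w (Icc 0 T) := fun t ht =>
    (hw t ht.1).continuousWithinAt.mono Icc_subset_Ici_self
  refine ⟨resH1.continuous.comp_continuousOn hc, congrArg resH1 h0, fun ψ hψ _ hψt φ hφ => ?_⟩
  obtain ⟨p, q, r, hpq, hqr, hp, hq, hr⟩ := hφ.exists_jet
  have e := fun t => weak_integral_eq f a (w t) p q r hp hq hr hpq hqr (deriv ψ t) (ψ t)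
  simp only [e]
  rw [intervalIntegral.integral_const_mul]
  have hd : ∀ t ∈ Ioo 0 T, HasDerivAt (fun t => ψ t * ⟪w t, ofC (p + q)⟫_ℝ)
      (deriv ψ t * ⟪w t, ofC (p + q)⟫_ℝ + ψ t * ⟪field f a (w t), ofC (p + q)⟫_ℝ) t := by
    intro t ht
    have h1 := (hw t ht.1.le).hasDerivAt (Ici_mem_nhds ht.1)
    have h2 := h1.inner ℝ (hasDerivAt_const t (ofC (p + q)))
    refine ((hψ.differentiable (by simp) t).hasDerivAt.fun_mul h2).congr_deriv ?_
    simp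
  have hψd : Continuous (deriv ψ) := hψ.continuous_deriv (by simp)
  have hψc : Continuous ψ := hψ.continuous
  have hc2 : ContinuousOn (fun t => field f a (w t)) (Icc 0 T) :=
    continuous_field.comp_continuousOn hc
  rw [intervalIntegral.integral_eq_sub_of_hasDerivAt_of_le hT.le
    (hψc.continuousOn.mul (hc.inner continuousOn_const)) hd]
  · have z : ∀ t ∉ Ioo 0 T, ψ t = 0 := fun t ht =>
      image_eq_zero_of_notMem_tsupport fun h => ht (hψt h)
    simp [z T, z 0]
  · refine ContinuousOn.intervalIntegrable_of_Icc hT.le ?_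
    exact (hψd.continuousOn.mul (hc.inner continuousOn_const)).add
      (hψc.continuousOn.mul (hc2.inner continuousOn_const))

/-- The real part of the `k`-th Fourier monomial. -/
def cosC (k : ℤ) : C(Torus, ℝ) := ⟨fun x => (fourier k x : ℂ).re, by fun_prop⟩

/-- The imaginary part of the `k`-th Fourier monomial. -/
def sinC (k : ℤ) : C(Torus, ℝ) := ⟨fun x => (fourier k x : ℂ).im, by fun_prop⟩

theorem contDiff_fourier (k : ℤ) :
    ContDiff ℝ ∞ fun x : ℝ => (fourier k (x : Torus) : ℂ) := by
  simp only [fourier_coe_apply]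
  have : ContDiff ℝ ∞ fun x : ℝ => (x : ℂ) := Complex.ofRealCLM.contDiff
  exact ((contDiff_const.mul this).div_const _).cexp

theorem smoothOnTorus_cosC (k : ℤ) : SmoothOnTorus (cosC k) :=
  Complex.reCLM.contDiff.comp (contDiff_fourier k)

theorem smoothOnTorus_sinC (k : ℤ) : SmoothOnTorus (sinC k) :=
  Complex.imCLM.contDiff.comp (contDiff_fourier k)

theorem hasDerivAt_fourier_torus (k : ℤ) (x : ℝ) :
    HasDerivAt (fun y : ℝ => (fourier k (y : Torus) : ℂ)) (Complex.I * k * fourier k (x : Torus))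
      x := by
  refine (hasDerivAt_fourier (2 * π) k x).congr_deriv ?_
  have : (π : ℂ) ≠ 0 := by exact_mod_cast Real.pi_ne_zero
  push_cast
  field_simp

theorem hasTorusDeriv_cosC (k : ℤ) : HasTorusDeriv (cosC k) (-((k : ℝ) • sinC k) : C(Torus, ℝ)) := by
  intro x
  refine (Complex.reCLM.hasFDerivAt.comp_hasDerivAt x (hasDerivAt_fourier_torus k x)).congr_deriv ?_
  simp [sinC]

theorem hasTorusDeriv_sinC (k : ℤ) : HasTorusDeriv (sinC k) ((k : ℝ) • cosC k : C(Torus, ℝ)) := by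
  intro x
  refine (Complex.imCLM.hasFDerivAt.comp_hasDerivAt x (hasDerivAt_fourier_torus k x)).congr_deriv ?_
  simp [cosC]

theorem re_fc (u : L2) (k : ℤ) : (fc u k).re = ⟪u, ofC (cosC k)⟫_ℝ := by
  have hint : Integrable (fun x => ((u x : ℝ) : ℂ)) haar :=
    ((Lp.memLp u).integrable (by norm_num)).ofReal
  rw [L2.inner_def, fc, fourierCoeff]
  refine (Complex.reCLM.integral_comp_comm (hint.fourier_smul (-k))).symm.trans ?_
  refine integral_congr_ae ?_
  filter_upwards [ofC_coe (cosC k)] with x hx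
  rw [hx]
  simp [cosC, mul_comm]

theorem im_fc (u : L2) (k : ℤ) : (fc u k).im = -⟪u, ofC (sinC k)⟫_ℝ := by
  have hint : Integrable (fun x => ((u x : ℝ) : ℂ)) haar :=
    ((Lp.memLp u).integrable (by norm_num)).ofReal
  rw [L2.inner_def, fc, fourierCoeff, ← integral_neg]
  refine (Complex.imCLM.integral_comp_comm (hint.fourier_smul (-k))).symm.trans ?_
  refine integral_congr_ae ?_
  filter_upwards [ofC_coe (sinC k)] with x hx
  rw [hx]
  simp [sinC, mul_comm]

/-- Functions `φ + φ'` suffice as tests: `φ = cos kx` and `φ = sin kx` give a linear system for the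
two pairings, of determinant `1 + k²`. -/
theorem eq_zero_of_forall_smooth_inner {z : L2}
    (h : ∀ p q : C(Torus, ℝ), SmoothOnTorus p → HasTorusDeriv p q → ⟪z, ofC (p + q)⟫_ℝ = 0) :
    z = 0 := by
  refine fc_injective fun k => ?_
  have h1 := h _ _ (smoothOnTorus_cosC k) (hasTorusDeriv_cosC k)
  have h2 := h _ _ (smoothOnTorus_sinC k) (hasTorusDeriv_sinC k)
  rw [map_add, inner_add_right, map_neg, map_smul, inner_neg_right, real_inner_smul_right] at h1
  rw [map_add, inner_add_right, map_smul, real_inner_smul_right] at h2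
  have hk : (0 : ℝ) < 1 + (k : ℝ) ^ 2 := by positivity
  have e1 : (1 + (k : ℝ) ^ 2) * ⟪z, ofC (cosC k)⟫_ℝ = 0 := by linear_combination h1 + k * h2
  have e2 : (1 + (k : ℝ) ^ 2) * ⟪z, ofC (sinC k)⟫_ℝ = 0 := by linear_combination h2 - k * h1
  apply Complex.ext
  · rw [re_fc, (mul_eq_zero.1 e1).resolve_left hk.ne', Complex.zero_re]
  · rw [im_fc, (mul_eq_zero.1 e2).resolve_left hk.ne', neg_zero, Complex.zero_im]

theorem IsSolution.exists_hasDerivWithinAt {w₀ : L2} {T : ℝ} (hT : 0 < T) {v : ℝ → H1}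
    (hv : IsSolution f a (resH1 w₀) T v) :
    ∃ w : ℝ → L2, w 0 = w₀ ∧ EqOn v (fun t => resH1 (w t)) (Icc 0 T) ∧
      ∀ t ∈ Icc 0 T, HasDerivWithinAt w (field f a (w t)) (Icc 0 T) t := by
  set J : L2 ≃ₗᵢ[ℝ] H1 := LinearIsometryEquiv.ofSurjective resH1 resH1_surjective with hJ
  have hJw : ∀ z, resH1 z = J z := fun _ => rfl
  -- Nothing is known of `v` outside `[0, T]`; constant extension makes `w` continuous on `ℝ`.
  set w : ℝ → L2 := IccExtend hT.le fun t => J.symm (v t) with hw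
  have hwt : ∀ t ∈ Icc 0 T, w t = J.symm (v t) := fun t ht => IccExtend_of_mem hT.le _ ht
  have hvt : EqOn v (fun t => resH1 (w t)) (Icc 0 T) := fun t ht => by
    simp only
    rw [hJw, hwt t ht, LinearIsometryEquiv.apply_symm_apply]
  have hwc : Continuous w :=
    Continuous.Icc_extend' (J.symm.continuous.comp hv.continuousOn.domRestrict)
  have hw0 : w 0 = w₀ := by
    rw [hwt 0 (left_mem_Icc.2 hT.le), hv.initial, hJw, LinearIsometryEquiv.symm_apply_apply]
  have hFc : Continuous fun t => field f a (w t) := continuous_field.comp hwc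
  have hint : ∀ t ∈ Icc 0 T, w t = w 0 + ∫ s in (0 : ℝ)..t, field f a (w s) := by
    intro t ht
    rw [← sub_eq_zero]
    refine eq_zero_of_forall_smooth_inner fun p q hp hpq => ?_
    obtain ⟨p', q', r, hpq', hqr, hp', hq', hr⟩ := hp.exists_jet
    obtain rfl : p' = p := ContinuousMap.ext hp'
    obtain rfl : q' = q := by
      ext x
      obtain ⟨x, rfl⟩ := QuotientAddGroup.mk_surjective x
      exact (hpq' x).unique (hpq x)
    have h1 := eq_add_integral_of_weak hT (g := fun t => ⟪w t, ofC (p' + q')⟫_ℝ)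
      (k := fun t => ⟪field f a (w t), ofC (p' + q')⟫_ℝ) (by fun_prop) (by fun_prop)
      (fun ψ hψ hψc hψt => by
        have e := hv.equation ψ hψ hψc hψt p' hp
        have e2 : EqOn (fun t => ∫ x in (0 : ℝ)..(2 * π),
            (-(deriv ψ t * v t (x : Torus) *
              (p' x - iteratedDeriv 2 (fun y : ℝ => p' y) x))
            - ψ t * f (v t (x : Torus)) * deriv (fun y : ℝ => p' y) x
            + ψ t * a x * v t (x : Torus) * p' x))
            (fun t => -(2 * π) * (deriv ψ t * ⟪w t, ofC (p' + q')⟫_ℝ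
              + ψ t * ⟪field f a (w t), ofC (p' + q')⟫_ℝ)) (uIcc 0 T) := by
          intro t ht
          rw [uIcc_of_le hT.le] at ht
          simp only [hvt ht]
          exact weak_integral_eq f a (w t) p' q' r hp' hq' hr hpq' hqr _ _
        rw [intervalIntegral.integral_congr e2, intervalIntegral.integral_const_mul] at e
        exact (mul_eq_zero.1 e).resolve_left (neg_ne_zero.2 Real.two_pi_pos.ne')) t ht
    have h2 : ⟪∫ s in (0 : ℝ)..t, field f a (w s), ofC (p' + q')⟫_ℝ
        = ∫ s in (0 : ℝ)..t, ⟪field f a (w s), ofC (p' + q')⟫_ℝ := by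
      have := (innerSL ℝ (ofC (p' + q'))).intervalIntegral_comp_comm
        (hFc.intervalIntegrable (μ := volume) 0 t)
      simp only [innerSL_apply_apply] at this
      rw [real_inner_comm, ← this]
      exact intervalIntegral.integral_congr fun s _ => real_inner_comm _ _
    rw [inner_sub_left, inner_add_left, h2, sub_eq_zero]
    exact h1
  refine ⟨w, hw0, hvt, fun t ht => ?_⟩
  have h1 : HasDerivAt (fun t => w 0 + ∫ s in (0 : ℝ)..t, field f a (w s)) (field f a (w t)) t :=
    (intervalIntegral.integral_hasDerivAt_right (hFc.intervalIntegrable _ _)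
      (hFc.stronglyMeasurableAtFilter _ _) hFc.continuousAt).const_add _
  exact h1.hasDerivWithinAt.congr hint (hint t ht)

end Weak

/-! ### Barbalat's lemma and its consequences for dissipative flows -/

section Barbalat

/-- Over a short step `h` the increment of `y` differs from `h z(t)` by at most `C h²`, while the
increment itself tends to zero. -/
theorem tendsto_deriv_zero_of_tendsto {E : Type*} [NormedAddCommGroup E] [NormedSpace ℝ E]
    {y z : ℝ → E} {C : ℝ} {l : E} (hC : 0 ≤ C)
    (hy : ∀ t ∈ Ici (0 : ℝ), HasDerivWithinAt y (z t) (Ici 0) t)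
    (hz : ∀ s ∈ Ici (0 : ℝ), ∀ t ∈ Ici (0 : ℝ), ‖z s - z t‖ ≤ C * |s - t|)
    (hl : Tendsto y atTop (𝓝 l)) : Tendsto z atTop (𝓝 0) := by
  rw [NormedAddGroup.tendsto_nhds_zero]
  intro ε hε
  -- Chosen so that `C h ≤ ε / 2`; the `+ 1` covers `C = 0`.
  set h : ℝ := ε / (2 * (C + 1)) with hh
  have hhpos : 0 < h := by positivity
  have hCh : C * h ≤ ε / 2 := by
    rw [hh, mul_div_assoc', div_le_div_iff₀ (by positivity) two_pos]
    nlinarith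
  have hdiff : Tendsto (fun t => y (t + h) - y t) atTop (𝓝 0) := by
    simpa using (hl.comp (tendsto_atTop_add_const_right atTop h tendsto_id)).sub hl
  filter_upwards [NormedAddGroup.tendsto_nhds_zero.1 hdiff (h * (ε / 2)) (by positivity),
    eventually_ge_atTop 0] with t ht ht0
  have hsub : Icc t (t + h) ⊆ Ici 0 := fun s hs => le_trans ht0 hs.1
  have h1 : ∀ s ∈ Icc t (t + h),
      HasDerivWithinAt (fun s => y s - s • z t) (z s - z t) (Icc t (t + h)) s := fun s hs => by
    have := ((hy s (hsub hs)).mono hsub).fun_sub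
      ((hasDerivWithinAt_id s (Icc t (t + h))).smul_const (z t))
    simpa using this
  have h2 := (convex_Icc t (t + h)).norm_image_sub_le_of_norm_hasDerivWithin_le (C := C * h) h1
    (fun s hs => (hz s (hsub hs) t ht0).trans (by
      gcongr
      rw [abs_of_nonneg (sub_nonneg.2 hs.1)]
      linarith [hs.2]))
    (left_mem_Icc.2 (by linarith)) (right_mem_Icc.2 (by linarith))
  have e : y (t + h) - (t + h) • z t - (y t - t • z t) = (y (t + h) - y t) - h • z t := by
    rw [add_smul]; abel
  rw [e, add_sub_cancel_left, Real.norm_of_nonneg hhpos.le] at h2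
  have h3 : h * ‖z t‖ ≤ ‖y (t + h) - y t‖ + ‖(y (t + h) - y t) - h • z t‖ := by
    have := norm_sub_le (y (t + h) - y t) ((y (t + h) - y t) - h • z t)
    rwa [sub_sub_cancel, norm_smul, Real.norm_of_nonneg hhpos.le] at this
  have h4 : h * ‖z t‖ < h * ε := by nlinarith
  exact lt_of_mul_lt_mul_left h4 hhpos.le

variable {E : Type*} [NormedAddCommGroup E] [InnerProductSpace ℝ E] {Φ : E → E} {w : ℝ → E}

theorem norm_le_of_solution (hΦ : ∀ v, ⟪v, Φ v⟫_ℝ ≤ 0)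
    (hw : ∀ t ∈ Ici (0 : ℝ), HasDerivWithinAt w (Φ (w t)) (Ici 0) t) {t : ℝ} (ht : 0 ≤ t) :
    ‖w t‖ ≤ ‖w 0‖ :=
  (pow_le_pow_iff_left₀ (norm_nonneg _) (norm_nonneg _) two_ne_zero).1
    (antitoneOn_norm_of_inner_nonpos (convex_Ici 0) hw hΦ self_mem_Ici ht ht)

theorem exists_bounds_of_solution
    (hlip : ∀ r, ∃ K : NNReal, LipschitzOnWith K Φ (Metric.closedBall 0 r))
    (hΦ : ∀ v, ⟪v, Φ v⟫_ℝ ≤ 0)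
    (hw : ∀ t ∈ Ici (0 : ℝ), HasDerivWithinAt w (Φ (w t)) (Ici 0) t) :
    ∃ C, 0 ≤ C ∧ (∀ t ∈ Ici (0 : ℝ), ‖Φ (w t)‖ ≤ C) ∧
      (∀ s ∈ Ici (0 : ℝ), ∀ t ∈ Ici (0 : ℝ), ‖w s - w t‖ ≤ C * |s - t|) ∧
      ∀ s ∈ Ici (0 : ℝ), ∀ t ∈ Ici (0 : ℝ), ‖Φ (w s) - Φ (w t)‖ ≤ C * |s - t| := by
  obtain ⟨K, hK⟩ := hlip ‖w 0‖
  have hmem : ∀ t ∈ Ici (0 : ℝ), w t ∈ Metric.closedBall (0 : E) ‖w 0‖ := fun t ht =>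
    mem_closedBall_zero_iff.2 (norm_le_of_solution hΦ hw ht)
  have h0 : (0 : E) ∈ Metric.closedBall (0 : E) ‖w 0‖ :=
    Metric.mem_closedBall_self (norm_nonneg _)
  set M : ℝ := ‖Φ 0‖ + K * ‖w 0‖ with hM
  have hM0 : 0 ≤ M := by positivity
  have hb : ∀ t ∈ Ici (0 : ℝ), ‖Φ (w t)‖ ≤ M := fun t ht => by
    have h1 := hK.dist_le_mul _ (hmem t ht) _ h0
    rw [dist_eq_norm, dist_zero_right] at h1
    refine (norm_le_norm_add_norm_sub' _ (Φ 0)).trans (add_le_add le_rfl (h1.trans ?_))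
    exact mul_le_mul_of_nonneg_left (norm_le_of_solution hΦ hw ht) K.2
  have hwl : ∀ s ∈ Ici (0 : ℝ), ∀ t ∈ Ici (0 : ℝ), ‖w s - w t‖ ≤ M * |s - t| :=
    fun s hs t ht => (convex_Ici 0).norm_image_sub_le_of_norm_hasDerivWithin_le hw hb ht hs
  have hKM : 0 ≤ K * M := by positivity
  refine ⟨M + K * M, by positivity, fun t ht => (hb t ht).trans (by linarith),
    fun s hs t ht => (hwl s hs t ht).trans ?_, fun s hs t ht => ?_⟩
  · gcongr
    linarith
  · have h1 := hK.dist_le_mul _ (hmem s hs) _ (hmem t ht)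
    rw [dist_eq_norm, dist_eq_norm] at h1
    calc ‖Φ (w s) - Φ (w t)‖ ≤ K * (M * |s - t|) :=
          h1.trans (mul_le_mul_of_nonneg_left (hwl s hs t ht) K.2)
      _ = (K * M) * |s - t| := by ring
      _ ≤ (M + K * M) * |s - t| := by gcongr; linarith

/-- Barbalat for `‖w‖²`: it converges, being nonincreasing and nonnegative, and its derivative is
Lipschitz since the orbit is bounded. -/
theorem tendsto_inner_field_zero
    (hlip : ∀ r, ∃ K : NNReal, LipschitzOnWith K Φ (Metric.closedBall 0 r))
    (hΦ : ∀ v, ⟪v, Φ v⟫_ℝ ≤ 0)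
    (hw : ∀ t ∈ Ici (0 : ℝ), HasDerivWithinAt w (Φ (w t)) (Ici 0) t) :
    Tendsto (fun t => ⟪w t, Φ (w t)⟫_ℝ) atTop (𝓝 0) := by
  obtain ⟨C, hC, h1, h2, h3⟩ := exists_bounds_of_solution hlip hΦ hw
  have hanti := antitoneOn_norm_of_inner_nonpos (convex_Ici 0) hw hΦ
  have hlim : ∃ l, Tendsto (fun t => ‖w t‖ ^ 2) atTop (𝓝 l) := by
    have hA : Antitone fun t => ‖w (max t 0)‖ ^ 2 := fun s t hst =>
      hanti (le_max_right s 0) (le_max_right t 0) (max_le_max_right 0 hst)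
    refine ⟨_, (tendsto_atTop_ciInf hA ⟨0, ?_⟩).congr' ?_⟩
    · rintro _ ⟨t, rfl⟩
      positivity
    · filter_upwards [eventually_ge_atTop 0] with t ht
      rw [max_eq_left ht]
  obtain ⟨l, hl⟩ := hlim
  have h4 := tendsto_deriv_zero_of_tendsto (C := 2 * (C * C + ‖w 0‖ * C)) (by positivity)
    (fun t ht => (hw t ht).norm_sq) (fun s hs t ht => ?_) hl
  · simpa using h4.div_const 2
  · have e : ⟪w s, Φ (w s)⟫_ℝ - ⟪w t, Φ (w t)⟫_ℝ
        = ⟪w s - w t, Φ (w s)⟫_ℝ + ⟪w t, Φ (w s) - Φ (w t)⟫_ℝ := by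
      rw [inner_sub_left, inner_sub_right]; ring
    have e1 : ‖⟪w s - w t, Φ (w s)⟫_ℝ‖ ≤ (C * |s - t|) * C :=
      (norm_inner_le_norm _ _).trans
        (mul_le_mul (h2 s hs t ht) (h1 s hs) (norm_nonneg _) (by positivity))
    have e2 : ‖⟪w t, Φ (w s) - Φ (w t)⟫_ℝ‖ ≤ ‖w 0‖ * (C * |s - t|) :=
      (norm_inner_le_norm _ _).trans
        (mul_le_mul (norm_le_of_solution hΦ hw ht) (h3 s hs t ht) (norm_nonneg _) (norm_nonneg _))
    rw [← mul_sub, e, norm_mul, Real.norm_two, mul_assoc]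
    refine mul_le_mul_of_nonneg_left ((norm_add_le _ _).trans ((add_le_add e1 e2).trans_eq ?_))
      two_pos.le
    ring

theorem tendsto_clm_field_zero
    (hlip : ∀ r, ∃ K : NNReal, LipschitzOnWith K Φ (Metric.closedBall 0 r))
    (hΦ : ∀ v, ⟪v, Φ v⟫_ℝ ≤ 0)
    (hw : ∀ t ∈ Ici (0 : ℝ), HasDerivWithinAt w (Φ (w t)) (Ici 0) t) (L : E →L[ℝ] E)
    (hL : Tendsto (fun t => L (w t)) atTop (𝓝 0)) :
    Tendsto (fun t => L (Φ (w t))) atTop (𝓝 0) := by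
  obtain ⟨C, hC, -, -, h3⟩ := exists_bounds_of_solution hlip hΦ hw
  refine tendsto_deriv_zero_of_tendsto (C := ‖L‖ * C) (by positivity)
    (fun t ht => L.hasFDerivAt.comp_hasDerivWithinAt t (hw t ht)) (fun s hs t ht => ?_) hL
  rw [← map_sub, mul_assoc]
  exact (L.le_opNorm _).trans (by gcongr; exact h3 s hs t ht)

theorem tendsto_inner_zero_of_dense {ι : Type*} {l : Filter ι} {w : ι → E} {D : Set E} {r : ℝ}
    (hD : Dense D) (hr : ∀ᶠ t in l, ‖w t‖ ≤ r)
    (h : ∀ v ∈ D, Tendsto (fun t => ⟪v, w t⟫_ℝ) l (𝓝 0)) (v : E) :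
    Tendsto (fun t => ⟪v, w t⟫_ℝ) l (𝓝 0) := by
  rw [NormedAddGroup.tendsto_nhds_zero]
  intro ε hε
  obtain ⟨v', hv', hvD⟩ := Metric.dense_iff.1 hD v (ε / (2 * (|r| + 1))) (by positivity)
  filter_upwards [NormedAddGroup.tendsto_nhds_zero.1 (h v' hvD) (ε / 2) (by positivity), hr]
    with t ht htr
  have e : ⟪v, w t⟫_ℝ = ⟪v - v', w t⟫_ℝ + ⟪v', w t⟫_ℝ := by rw [inner_sub_left]; ring
  have h1 : ‖v - v'‖ ≤ ε / (2 * (|r| + 1)) := by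
    rw [← dist_eq_norm, dist_comm]
    exact (Metric.mem_ball.1 hv').le
  have h2 : ‖⟪v - v', w t⟫_ℝ‖ ≤ ε / 2 := by
    refine (norm_inner_le_norm _ _).trans ((mul_le_mul h1
      (htr.trans ((le_abs_self r).trans (le_add_of_nonneg_right zero_le_one))) (norm_nonneg _)
      (by positivity)).trans_eq ?_)
    have : |r| + 1 ≠ 0 := by positivity
    field_simp
  rw [e]
  exact (norm_add_le _ _).trans_lt (by linarith)

end Barbalat

/-! ### Convergence to zero -/

section Asymptotics

variable {f : C(ℝ, ℝ)} {a : C(Torus, ℝ)}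

theorem inner_field_nonpos (ha : ∀ x, 0 ≤ a x) (v : L2) : ⟪v, field f a v⟫_ℝ ≤ 0 := by
  rw [inner_field]
  exact neg_nonpos.2 (inner_res_damp_nonneg ha v)

/-- The zero set of `g` is closed, and open because it is also the preimage of `(-δ, δ)`; the torus
is connected. -/
theorem eq_zero_of_comp_eq_zero {δ : ℝ} (hδ : 0 < δ)
    (hf : ∀ y ∈ Ioo (-δ) δ, f y = 0 ↔ y = 0) {g : C(Torus, ℝ)} (hfg : f.comp g = 0)
    (hg : ∃ x, g x = 0) : g = 0 := by
  have hclopen : IsClopen {x | g x = 0} := by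
    refine ⟨isClosed_eq g.continuous continuous_const, ?_⟩
    have e : {x | g x = 0} = g ⁻¹' Ioo (-δ) δ := by
      ext x
      constructor
      · intro hx
        change g x = 0 at hx
        simp [hx, hδ]
      · intro hx
        exact (hf _ hx).1 (congrArg (fun p : C(Torus, ℝ) => p x) hfg)
    rw [e]
    exact isOpen_Ioo.preimage g.continuous
  have := hclopen.eq_univ hg
  ext x
  exact this.symm.subset (mem_univ x)

theorem tendsto_resC_zero (hf : ContDiff ℝ 1 f) (hf_nonneg : ∀ y, 0 ≤ f y) {δ : ℝ} (hδ : 0 < δ)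
    (hf_zero : ∀ y ∈ Ioo (-δ) δ, f y = 0 ↔ y = 0) (ha : ∀ x, 0 ≤ a x) (ha_pos : ∃ x, 0 < a x)
    {w : ℝ → L2} (hw : ∀ t ∈ Ici (0 : ℝ), HasDerivWithinAt w (field f a (w t)) (Ici 0) t) :
    Tendsto (fun t => resC (w t)) atTop (𝓝 0) := by
  have hlip := exists_lipschitzOnWith_field (a := a) hf
  have hneg := inner_field_nonpos (f := f) ha
  have hdamp : Tendsto (fun t => damp a (w t)) atTop (𝓝 0) := by
    have h1 := ((tendsto_inner_field_zero hlip hneg hw).neg).const_mul ‖a‖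
    simp only [inner_field, neg_neg, neg_zero, mul_zero] at h1
    have h2 : Tendsto (fun t => ‖damp a (w t)‖ ^ 2) atTop (𝓝 0) :=
      squeeze_zero (fun t => by positivity) (fun t => norm_damp_sq_le ha (w t)) h1
    have h3 := h2.sqrt
    simp only [Real.sqrt_sq (norm_nonneg _), Real.sqrt_zero] at h3
    exact tendsto_zero_iff_norm_tendsto_zero.2 h3
  have hdampF := tendsto_clm_field_zero hlip hneg hw (damp a) hdamp
  -- Ultrafilters play the role of subsequences: by compactness each one has a limit `g`, and it
  -- remains to show `g = 0`.
  rw [tendsto_iff_ultrafilter]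
  intro U hU
  obtain ⟨g, -, hg⟩ : ∃ g ∈ closure (resC '' Metric.closedBall 0 ‖w 0‖),
      ((U.map fun t => resC (w t) : Ultrafilter C(Torus, ℝ)) : Filter C(Torus, ℝ)) ≤ 𝓝 g := by
    refine (isCompactOperator_resC.isCompact_closure_image_closedBall
      (f := (resC : L2 →ₗ[ℝ] C(Torus, ℝ))) ‖w 0‖).ultrafilter_le_nhds _ ?_
    rw [le_principal_iff]
    change ∀ᶠ t in (U : Filter ℝ), _
    filter_upwards [hU (eventually_ge_atTop 0)] with t ht
    exact subset_closure (mem_image_of_mem _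
      (mem_closedBall_zero_iff.2 (norm_le_of_solution hneg hw ht)))
  have hg' : Tendsto (fun t => resC (w t)) U (𝓝 g) := hg
  have hN : Tendsto (fun t => nonlin f (w t)) U (𝓝 (ofC (f.comp g))) :=
    ((ofC.continuous.comp (ContinuousMap.continuous_postcomp f)).tendsto g).comp hg'
  have hag : a * g = 0 := by
    apply ofC_injective
    rw [map_zero]
    refine tendsto_nhds_unique ?_ (hdamp.mono_left hU)
    exact ((ofC.continuous.comp (continuous_const_mul a)).tendsto g).comp hg'
  -- The limit of `a uₜ`; the term `(1 - ∂ₓ)⁻¹(a u)` in the field drops out because `a u → 0`.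
  have hres : a * resC (ofC (f.comp g) - resAdj (ofC (f.comp g))) = 0 := by
    apply ofC_injective
    rw [map_zero]
    refine tendsto_nhds_unique ?_ (hdampF.mono_left hU)
    have h1 : Tendsto (fun t => field f a (w t)) U
        (𝓝 (ofC (f.comp g) - resAdj (ofC (f.comp g) + 0))) :=
      hN.sub ((resAdj.continuous.tendsto _).comp (hN.add (hdamp.mono_left hU)))
    rw [add_zero] at h1
    exact ((damp a).continuous.tendsto _).comp h1
  have hgx : ∀ x, a x ≠ 0 → g x = 0 := fun x hx =>
    (mul_eq_zero.1 (congrArg (fun p : C(Torus, ℝ) => p x) hag)).resolve_left hx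
  obtain ⟨x₀, hx₀⟩ := ha_pos
  have hf0 : f 0 = 0 := (hf_zero 0 ⟨neg_lt_zero.2 hδ, hδ⟩).2 rfl
  have hfg : f.comp g = 0 := eq_zero_of_mul_resC_eq_zero (fun x => hf_nonneg _) ⟨x₀, hx₀.ne'⟩
    (fun x hx => by rw [ContinuousMap.comp_apply, hgx x hx, hf0]) hres
  rwa [eq_zero_of_comp_eq_zero hδ hf_zero hfg ⟨x₀, hgx x₀ hx₀.ne'⟩] at hg'

/-- With `x = 1 + k²` this is interpolation: the `H^s` norm is bounded by a large multiple of the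
`L²` norm, which tends to zero, plus a small multiple of the bounded `H¹` norm. -/
theorem exists_rpow_le_add_mul {s η : ℝ} (hs : s < 1) (hη : 0 < η) :
    ∃ C, 0 ≤ C ∧ ∀ x : ℝ, 1 ≤ x → x ^ s ≤ C + η * x := by
  have h1 := tendsto_rpow_neg_atTop (sub_pos.2 hs)
  obtain ⟨X, hX⟩ := eventually_atTop.1 (h1.eventually (ge_mem_nhds hη))
  refine ⟨max X 0, le_max_right _ _, fun x hx => ?_⟩
  have hx0 : 0 < x := by linarith
  rcases le_total X x with h | h
  · have h2 := hX x h
    rw [neg_sub] at h2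
    have e : x ^ s = x ^ (s - 1) * x := by
      rw [Real.rpow_sub_one hx0.ne', div_mul_cancel₀ _ hx0.ne']
    rw [e]
    exact (mul_le_mul_of_nonneg_right h2 hx0.le).trans (le_add_of_nonneg_left (le_max_right _ _))
  · have h2 : x ^ s ≤ x := by
      simpa using Real.rpow_le_rpow_of_exponent_le hx hs.le
    have h3 : 0 ≤ η * x := by positivity
    linarith [le_max_left X 0]

theorem tsum_sobolev_res_le {s η C : ℝ} (hη : 0 ≤ η) (hC : 0 ≤ C)
    (h : ∀ x : ℝ, 1 ≤ x → x ^ s ≤ C + η * x) (w : L2) :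
    ∑' k : ℤ, ENNReal.ofReal ((1 + (k : ℝ) ^ 2) ^ s * ‖fc (res w) k‖ ^ 2)
      ≤ ENNReal.ofReal (C * ‖res w‖ ^ 2 + η * ‖w‖ ^ 2) := by
  have h1 := ((hasSum_norm_fc_sq (res w)).mul_left C).add ((hasSum_norm_fc_sq w).mul_left η)
  rw [← h1.tsum_eq, ENNReal.ofReal_tsum_of_nonneg (fun k => by positivity) h1.summable]
  refine ENNReal.tsum_le_tsum fun k => ENNReal.ofReal_le_ofReal ?_
  rw [← norm_wfc_res w, norm_wfc_sq, ← mul_assoc, ← add_mul]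
  exact mul_le_mul_of_nonneg_right (h _ (by nlinarith [sq_nonneg (k : ℝ)])) (by positivity)

theorem tendsto_sobolevENorm_res {ι : Type*} {l : Filter ι} {w : ι → L2} {r s : ℝ} (hs : s < 1)
    (hr : ∀ᶠ t in l, ‖w t‖ ≤ r) (h : Tendsto (fun t => res (w t)) l (𝓝 0)) :
    Tendsto (fun t => sobolevENorm s (res (w t))) l (𝓝 0) := by
  have key : Tendsto
      (fun t => ∑' k : ℤ, ENNReal.ofReal ((1 + (k : ℝ) ^ 2) ^ s * ‖fc (res (w t)) k‖ ^ 2))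
      l (𝓝 0) := by
    rw [ENNReal.tendsto_nhds_zero]
    intro ε hε
    obtain ⟨ε', hε', hle⟩ := ENNReal.lt_iff_exists_real_btwn.1 hε
    have hpos : 0 < ε' := ENNReal.ofReal_pos.1 hle.1
    set η : ℝ := ε' / (2 * (r ^ 2 + 1)) with hη
    obtain ⟨C, hC, hCx⟩ := exists_rpow_le_add_mul hs (η := η) (by positivity)
    have h1 : Tendsto (fun t => C * ‖res (w t)‖ ^ 2) l (𝓝 0) := by
      simpa using (h.norm.pow 2).const_mul C
    filter_upwards [hr, h1.eventually (gt_mem_nhds (half_pos hpos))] with t ht ht'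
    refine (tsum_sobolev_res_le (by positivity) hC hCx (w t)).trans
      ((ENNReal.ofReal_le_ofReal ?_).trans hle.2.le)
    have h2 : η * ‖w t‖ ^ 2 ≤ η * (r ^ 2 + 1) := by
      have := pow_le_pow_left₀ (norm_nonneg _) ht 2
      gcongr
      linarith
    have h3 : η * (r ^ 2 + 1) = ε' / 2 := by
      rw [hη]
      field_simp
    linarith
  have h2 := ((ENNReal.continuous_rpow_const (y := 1 / 2)).tendsto 0).comp key
  rw [ENNReal.zero_rpow_of_pos (by norm_num)] at h2
  exact h2

/-- A functional on `H¹` pulls back to one on `L²`. Against the dense range of `resAdj` the pairing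
with `w` is a pairing with `res w`, which tends to zero; boundedness of `w` does the rest. -/
theorem tendsto_toWeakSpace_resH1 {ι : Type*} {l : Filter ι} {w : ι → L2} {r : ℝ}
    (hr : ∀ᶠ t in l, ‖w t‖ ≤ r) (h : Tendsto (fun t => res (w t)) l (𝓝 0)) :
    Tendsto (fun t => toWeakSpace ℝ H1 (resH1 (w t))) l (𝓝 0) := by
  have hinj : Function.Injective (topDualPairing ℝ H1).flip := by
    intro x y hxy
    exact (SeparatingDual.eq_iff_forall_dual_eq (R := ℝ)).2 fun g => congrArg (fun L => L g) hxy
  refine (WeakBilin.tendsto_iff_forall_eval_tendsto _ hinj).2 fun ℓ => ?_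
  have hw : ∀ v : L2, Tendsto (fun t => ⟪v, w t⟫_ℝ) l (𝓝 0) := by
    refine tendsto_inner_zero_of_dense denseRange_resAdj hr ?_
    rintro _ ⟨ζ, rfl⟩
    simp only [inner_resAdj_left]
    simpa using (tendsto_const_nhds (x := ζ)).inner h
  set L : StrongDual ℝ L2 := ℓ.comp resH1.toContinuousLinearMap with hL
  have h1 := hw ((InnerProductSpace.toDual ℝ L2).symm L)
  simp only [InnerProductSpace.toDual_symm_apply] at h1
  have h2 : (topDualPairing ℝ H1).flip 0 ℓ = 0 := map_zero ℓ
  exact h1.trans (congrArg 𝓝 h2.symm).le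

end Asymptotics

end BBM

end

theorem corollary4p2
    (f : ℝ → ℝ) (hf : ContDiff ℝ 1 f) (hf_nonneg : ∀ y, 0 ≤ f y)
    (δ : ℝ) (hδ : 0 < δ) (hf_zero : ∀ y ∈ Set.Ioo (-δ) δ, f y = 0 ↔ y = 0)
    (a : BBM.Torus → ℝ) (ha : BBM.SmoothOnTorus a) (ha_nonneg : ∀ x, 0 ≤ a x)
    (ha_pos : ∃ x, 0 < a x)
    (u₀ : BBM.H1) :
    ∃ u : ℝ → BBM.H1,
      (∀ T : ℝ, 0 < T → BBM.IsSolution f a u₀ T u ∧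
        ∀ v : ℝ → BBM.H1, BBM.IsSolution f a u₀ T v → Set.EqOn v u (Set.Icc 0 T)) ∧
      Filter.Tendsto (fun t : ℝ => toWeakSpace ℝ BBM.H1 (u t)) Filter.atTop (nhds 0) ∧
      ∀ s : ℝ, s < 1 →
        Filter.Tendsto (fun t : ℝ => BBM.sobolevENorm s (BBM.H1.toL2 (u t)))
          Filter.atTop (nhds 0) := by
  obtain ⟨w₀, rfl⟩ := BBM.resH1_surjective u₀
  obtain ⟨α, -, -, -, hα, -⟩ := ha.exists_hasTorusDeriv
  obtain rfl : ⇑α = a := funext hα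
  lift f to C(ℝ, ℝ) using hf.continuous
  have hlip := BBM.exists_lipschitzOnWith_field (a := α) hf
  have hneg := BBM.inner_field_nonpos (f := f) ha_nonneg
  obtain ⟨w, hw0, hw⟩ := BBM.exists_solution_Ici hlip hneg w₀
  have hres : Filter.Tendsto (fun t => BBM.res (w t)) Filter.atTop (nhds 0) := by
    have h := BBM.tendsto_resC_zero hf hf_nonneg hδ hf_zero ha_nonneg ha_pos hw
    have h' := (BBM.ofC.continuous.tendsto 0).comp h
    rwa [map_zero] at h'
  have hr : ∀ᶠ t in Filter.atTop, ‖w t‖ ≤ ‖w 0‖ := by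
    filter_upwards [Filter.eventually_ge_atTop 0] with t ht
    exact BBM.norm_le_of_solution hneg hw ht
  refine ⟨fun t => BBM.resH1 (w t), fun T hT => ⟨BBM.isSolution_resH1 hw0 hw hT, fun v hv => ?_⟩,
    BBM.tendsto_toWeakSpace_resH1 hr hres, fun s hs => BBM.tendsto_sobolevENorm_res hs hr hres⟩
  obtain ⟨w', hw0', hv', hw'⟩ := hv.exists_hasDerivWithinAt hT
  have hww := BBM.eqOn_of_solution_Icc hlip hw'
    (fun t ht => (hw t ht.1).mono Set.Icc_subset_Ici_self) (hw0'.trans hw0.symm)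
  exact fun t ht => (hv' ht).trans (congrArg BBM.resH1 (hww ht))
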